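/- Let $\mathbb{R}^{2,2}$ be $\mathbb{R}^4$ with the bilinear form $\langle x,y\rangle=x^1y^1+x^2y^2-x^3y^3-x^4y^4$, let $\mathbb{A}\mathrm{d}\mathbb{S}^3=\mathrm{P}(\{\langle x,x\rangle<0\})\subset\mathbb{R}\mathrm{P}^3$ be Anti-de Sitter space (with the metric induced from $\{\langle x,x\rangle=-1\}$), and let $\partial_\infty\mathbb{A}\mathrm{d}\mathbb{S}^3=\mathrm{P}(\{\langle x,x\rangle=0\})$ be its boundary at infinity, identified with $\mathbb{R}\mathrm{P}^1\times\mathbb{R}\mathrm{P}^1$ by sending a point to its left and right projections, along the two rulings of the quadric, to the circle $\partial_\infty P$ with $P=\{x^4=0\}$; here $[\cos\theta,\sin\theta,1,0]\in\partial_\infty P$ is identified with $\tan(\theta/2)\in\mathbb{R}\cup\{\infty\}=\mathbb{R}\mathrm{P}^1$. For an orientation-preserving homeomorphism $\phi:\mathbb{R}\mathrm{P}^1\to\mathbb{R}\mathrm{P}^1$ let $$\|\phi\|_{cr}=\sup_{cr(Q)=-1}\bigl|\ln|cr(\phi(Q))|\bigr|\in[0,\infty],\qquad cr(z_1,z_2,z_3,z_4)=\frac{(z_4-z_1)(z_3-z_2)}{(z_2-z_1)(z_3-z_4)},$$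 where $Q$ runs over quadruples of points of $\mathbb{R}\mathrm{P}^1$; $\phi$ is called quasisymmetric if $\|\phi\|_{cr}<\infty$. Let $gr(\phi)\subset\partial_\infty\mathbb{A}\mathrm{d}\mathbb{S}^3$ be the graph of $\phi$. Its convex hull is the intersection of all half-spaces (of affine charts of $\mathbb{R}\mathrm{P}^3$ containing $gr(\phi)$) which contain $gr(\phi)$ and are bounded by planes disjoint from $gr(\phi)$. The width $w$ of the convex hull is the supremum of the lengths of the timelike geodesic segments contained in it (equal to $0$ if there are none). Then, for every quasisymmetric homeomorphism $\phi$ of $\mathbb{R}\mathrm{P}^1$, one has $w<\pi/2$ and $$\tan w\leq\sinh\left(\frac{\|\phi\|_{cr}}{2}\right).$$ -/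

import Mathlib

open Set Topology
open scoped NNReal ENNReal LinearAlgebra.Projectivization

namespace AdSWidth

/-! The real projective line is `OnePoint ℝ = ℝ ∪ {∞}`. -/

/-- Homogeneous coordinates `[u : v]` on the projective line: `x = [x : 1]` and `∞ = [1 : 0]`. -/
def homCoord : OnePoint ℝ → ℝ × ℝ
  | none => (1, 0)
  | some x => (x, 1)

/-- The determinant of a pair of plane vectors. -/
def det2 (a b : ℝ × ℝ) : ℝ := a.1 * b.2 - a.2 * b.1

/-- The homogeneous form of the difference `a - b` of two points of the projective line
(for finite `a`, `b` it is literally `a - b`). -/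
def diff (a b : OnePoint ℝ) : ℝ := det2 (homCoord a) (homCoord b)

/-- The cross-ratio
`cr(z₁,z₂,z₃,z₄) = (z₄ - z₁)(z₃ - z₂) / ((z₂ - z₁)(z₃ - z₄))`,
with the usual meaning when one of the points is `∞`. -/
noncomputable def crossRatio (z₁ z₂ z₃ z₄ : OnePoint ℝ) : ℝ :=
  (diff z₄ z₁ * diff z₃ z₂) / (diff z₂ z₁ * diff z₃ z₄)

/-- `a`, `b`, `c` are distinct and in the positive cyclic order of the projective line
(for finite points: `a < b < c` up to a cyclic permutation). -/
def PosCyclic (a b c : OnePoint ℝ) : Prop := 0 < diff a b * diff b c * diff c a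

/-- A homeomorphism of the projective line preserves the orientation if it preserves
the cyclic order. -/
def OrientationPreserving (φ : OnePoint ℝ ≃ₜ OnePoint ℝ) : Prop :=
  ∀ a b c, PosCyclic a b c → PosCyclic (φ a) (φ b) (φ c)

/-- The cross-ratio norm, an element of `[0, ∞]`: the supremum of `|ln |cr(φ(Q))||` over all
quadruples `Q` with `cr(Q) = -1` (the points of such a quadruple are automatically distinct). -/
noncomputable def crossRatioNorm (φ : OnePoint ℝ ≃ₜ OnePoint ℝ) : ℝ≥0∞ :=
  ⨆ (z₁ : OnePoint ℝ) (z₂ : OnePoint ℝ) (z₃ : OnePoint ℝ) (z₄ : OnePoint ℝ)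
    (_ : crossRatio z₁ z₂ z₃ z₄ = -1),
    ENNReal.ofReal (abs (Real.log (abs (crossRatio (φ z₁) (φ z₂) (φ z₃) (φ z₄)))))

/-- Quasisymmetric homeomorphisms of the projective line. -/
def Quasisymmetric (φ : OnePoint ℝ ≃ₜ OnePoint ℝ) : Prop :=
  OrientationPreserving φ ∧ crossRatioNorm φ < ⊤

/-! Anti-de Sitter space as a domain of three-dimensional projective space. -/

/-- The vector space underlying `ℝ^{2,2}`; the coordinates `x¹, x², x³, x⁴` have indices
`0, 1, 2, 3`. -/
abbrev R22 : Type := Fin 4 → ℝ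

/-- The bilinear form of signature `(2,2)`. -/
def form (x y : R22) : ℝ := x 0 * y 0 + x 1 * y 1 - x 2 * y 2 - x 3 * y 3

/-- Anti-de Sitter space, the projectivization of the negative vectors. -/
def AdS : Set (ℙ ℝ R22) := {x | form x.rep x.rep < 0}

/-- The boundary at infinity, the projectivization of the null vectors. -/
def AdSBoundary : Set (ℙ ℝ R22) := {x | form x.rep x.rep = 0}

/-- The Segre map `([u : v], [s : t]) ↦ [vt - us, ut + vs, vt + us, ut - vs]`.
With `u/v = tan (α/2)` and `s/t = tan (β/2)` this is the point
`[cos ((α+β)/2), sin ((α+β)/2), cos ((α-β)/2), sin ((α-β)/2)]`. -/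
def segre (a b : ℝ × ℝ) : R22 :=
  ![a.2 * b.2 - a.1 * b.1, a.1 * b.2 + a.2 * b.1, a.2 * b.2 + a.1 * b.1, a.1 * b.2 - a.2 * b.1]

theorem form_segre (a b c d : ℝ × ℝ) :
    form (segre a b) (segre c d) = -2 * det2 a c * det2 b d := by
  simp [form, segre, det2]
  ring

theorem segre_homCoord_ne_zero (a b : OnePoint ℝ) : segre (homCoord a) (homCoord b) ≠ 0 := by
  intro h
  have h0 := congrFun h 0
  have h1 := congrFun h 1
  have h2 := congrFun h 2
  have h3 := congrFun h 3
  rcases a with _ | a <;> rcases b with _ | b <;>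
    simp [segre, homCoord] at h0 h1 h2 h3
  linarith

/-- The identification of `ℝP¹ × ℝP¹` with the boundary at infinity. The spacelike plane used for
it is `P = {x⁴ = 0}`, whose boundary at infinity is the circle of the points `bdryPoint a a`, i.e.
`[cos α, sin α, 1, 0]` with `a = tan (α/2)`. The points `bdryPoint a b` with `a` fixed form the line
of the left ruling through `bdryPoint a a`, and those with `b` fixed form the line of the right
ruling through `bdryPoint b b`, so that `a` and `b` are the left and the right projection to
`∂P` of `bdryPoint a b`. -/
noncomputable def bdryPoint (a b : OnePoint ℝ) : ℙ ℝ R22 :=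
  Projectivization.mk ℝ (segre (homCoord a) (homCoord b)) (segre_homCoord_ne_zero a b)

/-- The graph of `φ` as a curve in the boundary at infinity. -/
def graphCurve (φ : OnePoint ℝ ≃ₜ OnePoint ℝ) : Set (ℙ ℝ R22) :=
  range fun a => bdryPoint a (φ a)

/-- The projective plane dual to (the class of) a vector. Every totally geodesic plane is of this
form, up to intersection with Anti-de Sitter space. -/
def plane (n : R22) : Set (ℙ ℝ R22) := {x | form n x.rep = 0}

/-- A closed half-space bounded by the plane dual to `n`, in the affine chart that is the
complement of the plane dual to `m`; the other half-space is `halfSpace (-n) m`. -/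
def halfSpace (n m : R22) : Set (ℙ ℝ R22) :=
  {x | form m x.rep ≠ 0 ∧ 0 ≤ form n x.rep / form m x.rep}

/-- The convex hull of a curve at infinity: the intersection of the half-spaces that contain the
curve and are bounded by planes disjoint from the curve. Half-spaces are taken in the affine
charts containing the curve, because one plane alone does not disconnect projective space. -/
def hull (Γ : Set (ℙ ℝ R22)) : Set (ℙ ℝ R22) :=
  {x | ∀ n m : R22, Disjoint (plane n) Γ → Disjoint (plane m) Γ → Γ ⊆ halfSpace n m →
    x ∈ halfSpace n m}

/-- A point `p` of the double cover `{⟨p,p⟩ = -1}` of Anti-de Sitter space together with a unit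
timelike tangent vector `v` at `p` (the tangent space at `p` is `p^⊥`). -/
structure UnitTimelike where
  p : R22
  v : R22
  form_pp : form p p = -1
  form_vv : form v v = -1
  form_pv : form p v = 0

theorem form_cos_sin (u : UnitTimelike) (t : ℝ) :
    form (Real.cos t • u.p + Real.sin t • u.v) (Real.cos t • u.p + Real.sin t • u.v) = -1 := by
  have h1 := u.form_pp
  have h2 := u.form_vv
  have h3 := u.form_pv
  have h4 := Real.sin_sq_add_cos_sq t
  simp only [form, Pi.add_apply, Pi.smul_apply, smul_eq_mul] at *
  linear_combination (Real.cos t) ^ 2 * h1 + (Real.sin t) ^ 2 * h2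
    + 2 * Real.cos t * Real.sin t * h3 - h4

/-- The unit speed timelike geodesic `t ↦ [cos t p + sin t v]`. -/
noncomputable def timelikeGeodesic (u : UnitTimelike) (t : ℝ) : ℙ ℝ R22 :=
  Projectivization.mk ℝ (Real.cos t • u.p + Real.sin t • u.v) (by
    intro h
    have h1 := form_cos_sin u t
    rw [h] at h1
    simp [form] at h1)

/-- The width of a subset of projective space, an element of `[0, ∞]`: the supremum of the lengths
of the timelike geodesic segments contained in it. (The geodesics have unit speed, so the segment
parametrized by `[0, ℓ]` has length `ℓ`.) -/
noncomputable def width (C : Set (ℙ ℝ R22)) : ℝ≥0∞ :=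
  ⨆ (u : UnitTimelike) (ℓ : ℝ≥0) (_ : ∀ t ∈ Icc (0 : ℝ) ℓ, timelikeGeodesic u t ∈ C), (ℓ : ℝ≥0∞)

end AdSWidth

namespace AdSWidth

/-! ### The symplectic plane -/

/-! Some plane `form m = 0` misses the graph. In the chart `form m = 1` the graph is a compact set T
of null vectors with nonpositive mutual products, and the hull lies in the convex hull of T. Given a
timelike segment in the hull with ends p, q and length ℓ < π/2, prolong the ray from q through p to
its exit point p' (`exists_exit`). There p' is a convex combination of the points where a support
plane n touches the curve. As p' is not null, there are at least two of them, so the plane is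
spacelike (`IsPositiveLift.form_self_neg`). Scale n so that ⟨n,n⟩ = ⟨p',p'⟩. By `form_mul_form_le`,
q lies far enough behind this plane to force a curve point x with tan ℓ · (-⟨p',x⟩) ≤ ⟨n,x⟩.

The rest is one-dimensional (`IsPositiveLift.le_sinh`). On the quadric n is the form det(a, `twist n
b`), so ψ = `twist n` ∘ φ fixes the contact points and moves the other points in one direction. In a
coordinate with x = ∞ and ψ(x) = 0 the contact points are negative numbers t_i. The norm of p'
prescribes the variance of the t_i for suitable positive weights, and the choice of x bounds their
mean. Hence two of them, t_j < t_i, have a ratio X = t_j / t_i with tan ℓ ≤ (X - 1) / (2√X) = sinh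
(ln X / 2). The midpoint y of t_i and t_j completes t_i, ∞, t_j to a harmonic quadruple. Since ψ(y)
≤ y, the image has cross-ratio at least X in absolute value, whence ln X ≤ ‖φ‖. -/

@[simp] theorem det2_self (a : ℝ × ℝ) : det2 a a = 0 := by simp only [det2]; ring

theorem det2_swap (a b : ℝ × ℝ) : det2 a b = -det2 b a := by simp only [det2]; ring

theorem det2_smul_left (r : ℝ) (a b : ℝ × ℝ) : det2 (r • a) b = r * det2 a b := by
  simp only [det2, Prod.smul_fst, Prod.smul_snd, smul_eq_mul]; ring

theorem det2_smul_right (r : ℝ) (a b : ℝ × ℝ) : det2 a (r • b) = r * det2 a b := by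
  simp only [det2, Prod.smul_fst, Prod.smul_snd, smul_eq_mul]; ring

theorem det2_add_left (a b c : ℝ × ℝ) : det2 (a + b) c = det2 a c + det2 b c := by
  simp only [det2, Prod.fst_add, Prod.snd_add]; ring

theorem det2_add_right (a b c : ℝ × ℝ) : det2 a (b + c) = det2 a b + det2 a c := by
  simp only [det2, Prod.fst_add, Prod.snd_add]; ring

/-- When `det2 x e = 1`, this expands determinants in the coordinates given by the basis x, e. -/
theorem det2_plucker (x e v w : ℝ × ℝ) :
    det2 v w * det2 x e = det2 v e * det2 x w - det2 x v * det2 w e := by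
  simp only [det2]; ring

/-- Two vectors are proportional if their determinant vanishes. -/
theorem exists_smul_of_det2_eq_zero {a b : ℝ × ℝ} (ha : a ≠ 0) (h : det2 a b = 0) :
    ∃ r : ℝ, b = r • a := by
  have h' : a.1 * b.2 = a.2 * b.1 := by simp only [det2] at h; linarith
  by_cases h1 : a.1 = 0
  · have h2 : a.2 ≠ 0 := fun h2 => ha (Prod.ext h1 h2)
    refine ⟨b.2 / a.2, Prod.ext ?_ ?_⟩
    · simp only [Prod.smul_fst, smul_eq_mul]; field_simp; linarith
    · simp only [Prod.smul_snd, smul_eq_mul]; field_simp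
  · refine ⟨b.1 / a.1, Prod.ext ?_ ?_⟩
    · simp only [Prod.smul_fst, smul_eq_mul]; field_simp
    · simp only [Prod.smul_snd, smul_eq_mul]; field_simp; linarith

/-- The cross-ratio of four vectors of the plane. -/
noncomputable def vectorCrossRatio (v₁ v₂ v₃ v₄ : ℝ × ℝ) : ℝ :=
  (det2 v₄ v₁ * det2 v₃ v₂) / (det2 v₂ v₁ * det2 v₃ v₄)

theorem vectorCrossRatio_smul {r₁ r₂ r₃ r₄ : ℝ} (h₁ : r₁ ≠ 0) (h₂ : r₂ ≠ 0) (h₃ : r₃ ≠ 0)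
    (h₄ : r₄ ≠ 0) (v₁ v₂ v₃ v₄ : ℝ × ℝ) :
    vectorCrossRatio (r₁ • v₁) (r₂ • v₂) (r₃ • v₃) (r₄ • v₄) = vectorCrossRatio v₁ v₂ v₃ v₄ := by
  simp only [vectorCrossRatio, det2_smul_left, det2_smul_right]
  rw [show r₁ * (r₄ * det2 v₄ v₁) * (r₂ * (r₃ * det2 v₃ v₂)) =
      (r₁ * r₂ * r₃ * r₄) * (det2 v₄ v₁ * det2 v₃ v₂) by ring,
    show r₁ * (r₂ * det2 v₂ v₁) * (r₄ * (r₃ * det2 v₃ v₄)) =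
      (r₁ * r₂ * r₃ * r₄) * (det2 v₂ v₁ * det2 v₃ v₄) by ring]
  exact mul_div_mul_left _ _ (by positivity)

/-! ### The bilinear form -/

theorem form_comm (x y : R22) : form x y = form y x := by simp only [form]; ring

theorem form_add_right (x y z : R22) : form x (y + z) = form x y + form x z := by
  simp only [form, Pi.add_apply]; ring

theorem form_sub_right (x y z : R22) : form x (y - z) = form x y - form x z := by
  simp only [form, Pi.sub_apply]; ring

theorem form_smul_right (r : ℝ) (x y : R22) : form x (r • y) = r * form x y := by
  simp only [form, Pi.smul_apply, smul_eq_mul]; ring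

theorem form_add_left (x y z : R22) : form (x + y) z = form x z + form y z := by
  simp only [form, Pi.add_apply]; ring

theorem form_sub_left (x y z : R22) : form (x - y) z = form x z - form y z := by
  simp only [form, Pi.sub_apply]; ring

theorem form_smul_left (r : ℝ) (x y : R22) : form (r • x) y = r * form x y := by
  simp only [form, Pi.smul_apply, smul_eq_mul]; ring

/-- The linear functional dual to a vector. -/
def formLin (x : R22) : R22 →ₗ[ℝ] ℝ where
  toFun := form x
  map_add' := form_add_right x
  map_smul' r y := form_smul_right r x y

@[simp] theorem formLin_apply (x y : R22) : formLin x y = form x y := rfl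

theorem form_sum_right {ι : Type*} (s : Finset ι) (x : R22) (w : ι → ℝ) (y : ι → R22) :
    form x (∑ i ∈ s, w i • y i) = ∑ i ∈ s, w i * form x (y i) := by
  rw [← formLin_apply, map_sum]
  simp

theorem continuous_form : Continuous fun p : R22 × R22 => form p.1 p.2 := by
  unfold form; fun_prop

theorem exists_form_eq (g : R22 →ₗ[ℝ] ℝ) : ∃ x, ∀ y, g y = form x y := by
  refine ⟨![g (Pi.single 0 1), g (Pi.single 1 1), -g (Pi.single 2 1), -g (Pi.single 3 1)],
    fun y => ?_⟩
  rw [LinearMap.pi_apply_eq_sum_univ g y, Fin.sum_univ_four]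
  have hs : ∀ i : Fin 4, (fun j => if i = j then (1 : ℝ) else 0) = Pi.single i 1 := by
    intro i; ext j; simp [Pi.single_apply, eq_comm]
  simp only [hs, form, smul_eq_mul]
  simp
  ring

/-- The matrix that turns the functional of `n` on the quadric into a determinant. -/
def twist (n : R22) (b : ℝ × ℝ) : ℝ × ℝ :=
  (-(b.1 * (n 1 + n 3) + b.2 * (n 0 - n 2)), -b.1 * (n 0 + n 2) + b.2 * (n 1 - n 3))

/-- A plane with nonzero form n n thus cuts the quadric in the graph of a projective map, and a
contact point of a curve becomes a fixed point. -/
theorem form_segre_eq_det2 (n : R22) (a b : ℝ × ℝ) : form n (segre a b) = det2 a (twist n b) := by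
  simp [form, segre, det2, twist]; ring

theorem det2_twist (n : R22) (b d : ℝ × ℝ) :
    det2 (twist n b) (twist n d) = -form n n * det2 b d := by
  simp only [form, det2, twist]; ring

theorem segre_smul_right (r : ℝ) (a b : ℝ × ℝ) : segre a (r • b) = r • segre a b := by
  ext i; fin_cases i <;> simp [segre] <;> ring

theorem segre_smul_left (r : ℝ) (a b : ℝ × ℝ) : segre (r • a) b = r • segre a b := by
  ext i; fin_cases i <;> simp [segre] <;> ring

theorem form_self_nonneg_of_eq_zero {x : R22} (h₂ : x 2 = 0) (h₃ : x 3 = 0) : 0 ≤ form x x := by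
  simp only [form, h₂, h₃]; nlinarith [sq_nonneg (x 0), sq_nonneg (x 1)]

/-- The orthogonal complement of a negative definite plane is positive semidefinite. -/
theorem form_self_nonneg_of_orthogonal {p n e : R22} (hp : form p p < 0)
    (hn : form n n = form p p) (hpn : form p n = 0) (hpe : form p e = 0) (hne : form n e = 0) :
    0 ≤ form e e := by
  have expand : ∀ a b c : ℝ, form (a • p + b • n + c • e) (a • p + b • n + c • e) =
      (a ^ 2 + b ^ 2) * form p p + c ^ 2 * form e e := by
    intro a b c
    simp only [form_add_left, form_add_right, form_smul_left, form_smul_right,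
      form_comm n p, form_comm e p, form_comm e n, hpn, hpe, hne, hn]
    ring
  by_contra he
  push Not at he
  have neg : ∀ a b c : ℝ, a * p 2 + b * n 2 + c * e 2 = 0 → a * p 3 + b * n 3 + c * e 3 = 0 →
      a = 0 ∧ b = 0 ∧ c = 0 := by
    intro a b c h2 h3
    have h := form_self_nonneg_of_eq_zero (x := a • p + b • n + c • e) (by simpa using h2)
      (by simpa using h3)
    rw [expand] at h
    have ha : a ^ 2 * form p p ≤ 0 := mul_nonpos_of_nonneg_of_nonpos (sq_nonneg _) hp.le
    have hb : b ^ 2 * form p p ≤ 0 := mul_nonpos_of_nonneg_of_nonpos (sq_nonneg _) hp.le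
    have hc : c ^ 2 * form e e ≤ 0 := mul_nonpos_of_nonneg_of_nonpos (sq_nonneg _) he.le
    have ha0 : a ^ 2 * form p p = 0 := by linarith
    have hb0 : b ^ 2 * form p p = 0 := by linarith
    have hc0 : c ^ 2 * form e e = 0 := by linarith
    simp only [mul_eq_zero, hp.ne, he.ne, or_false, pow_eq_zero_iff, ne_eq, OfNat.ofNat_ne_zero,
      not_false_eq_true] at ha0 hb0 hc0
    exact ⟨ha0, hb0, hc0⟩
  -- The coefficients are the cross product of the two rows of negative coordinates, so both
  -- coordinates vanish. Independence of p, n, e is not assumed, so a zero coefficient is only a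
  -- relation between p and n, exploited next.
  obtain ⟨-, -, hc⟩ := neg (n 2 * e 3 - n 3 * e 2) (e 2 * p 3 - e 3 * p 2)
    (p 2 * n 3 - p 3 * n 2) (by ring) (by ring)
  obtain ⟨h2, h2', -⟩ := neg (n 2) (-p 2) 0 (by ring) (by linear_combination -hc)
  obtain ⟨h3, h3', -⟩ := neg (n 3) (-p 3) 0 (by linear_combination hc) (by ring)
  exact absurd (form_self_nonneg_of_eq_zero (x := p) (by linarith) (by linarith)) (by linarith)

/-- A Bessel inequality: up to the factor `form p p`, the vector used is the component of q
orthogonal to the negative definite plane of p and n. -/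
theorem form_mul_form_le {p n q : R22} (hp : form p p < 0)
    (hn : form n n = form p p) (hpn : form p n = 0) :
    form p p * form q q ≤ form p q ^ 2 + form n q ^ 2 := by
  have hp0 : form p p ≠ 0 := hp.ne
  have h := form_self_nonneg_of_orthogonal
    (e := form p p • q - form p q • p - form n q • n) hp hn hpn
    (by simp only [form_sub_right, form_smul_right, hpn]; ring)
    (by simp only [form_sub_right, form_smul_right, form_comm n p, hpn, hn]; ring)
  have h' : form (form p p • q - form p q • p - form n q • n)
      (form p p • q - form p q • p - form n q • n) =
      form p p * (form p p * form q q - form p q ^ 2 - form n q ^ 2) := by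
    simp only [form_sub_right, form_smul_right, form_sub_left, form_smul_left, form_comm n p, hpn,
      hn, form_comm q p, form_comm q n]
    ring
  rw [h'] at h
  nlinarith

/-! ### Estimates on the line -/

/-- A centred configuration of unit variance spreads on both sides of its mean. -/
theorem exists_mul_le_neg_one {ι : Type*} [Fintype ι] (c u : ι → ℝ) (hc : ∀ i, 0 < c i)
    (h₀ : 0 < ∑ i, c i) (h₁ : ∑ i, c i * u i = 0) (h₂ : ∑ i, c i * u i ^ 2 = ∑ i, c i) :
    ∃ i j, u i * u j ≤ -1 ∧ u j < 0 ∧ 0 < u i := by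
  have hne : Nonempty ι := by
    by_contra h
    rw [not_nonempty_iff] at h
    simp at h₀
  obtain ⟨i, -, hi⟩ := Finset.exists_max_image Finset.univ u Finset.univ_nonempty
  obtain ⟨j, -, hj⟩ := Finset.exists_min_image Finset.univ u Finset.univ_nonempty
  -- Every value lies between the minimum and the maximum; the weighted sum of these products is (1
  -- + max · min) Σ c.
  have h : ∑ k, c k * ((u k - u i) * (u k - u j)) ≤ 0 := by
    refine Finset.sum_nonpos fun k hk => mul_nonpos_of_nonneg_of_nonpos (hc k).le ?_
    exact mul_nonpos_of_nonpos_of_nonneg (by linarith [hi k hk]) (by linarith [hj k hk])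
  have h' : ∑ k, c k * ((u k - u i) * (u k - u j)) = (1 + u i * u j) * ∑ k, c k := by
    have : ∀ k, c k * ((u k - u i) * (u k - u j)) =
        c k * u k ^ 2 - (u i + u j) * (c k * u k) + u i * u j * c k := fun k => by ring
    simp only [this, Finset.sum_add_distrib, Finset.sum_sub_distrib, ← Finset.mul_sum, h₁, h₂]
    ring
  rw [h'] at h
  have hprod : u i * u j ≤ -1 := by nlinarith
  have hle := hj i (Finset.mem_univ i)
  refine ⟨i, j, hprod, ?_, ?_⟩ <;> nlinarith

/-- The case k = 1 / T is extremal, and there T²(M + m)² - 4(T + m)(T - M) = (T(m - M) - 2)² + 4(T²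
+ 1)(Mm - 1). -/
theorem four_mul_sq_mul_le {k T M m : ℝ} (hT : 0 < T) (hk : 0 < k) (hkT : k * T ≤ 1)
    (hMm : 1 ≤ M * m) :
    4 * k ^ 2 * ((T + m) * (T - M)) ≤ (M + m) ^ 2 := by
  have h1 : 4 * ((T + m) * (T - M)) ≤ T ^ 2 * (M + m) ^ 2 := by
    nlinarith [sq_nonneg (T * (m - M) - 2), mul_le_mul_of_nonneg_left hMm (sq_nonneg T)]
  have h2 : (k * T) ^ 2 ≤ 1 := by
    rw [sq_le_one_iff_abs_le_one, abs_of_pos (by positivity)]; exact hkT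
  have h3 : k ^ 2 * (4 * ((T + m) * (T - M))) ≤ k ^ 2 * (T ^ 2 * (M + m) ^ 2) :=
    mul_le_mul_of_nonneg_left h1 (sq_nonneg k)
  have h4 : (k * T) ^ 2 * (M + m) ^ 2 ≤ 1 * (M + m) ^ 2 :=
    mul_le_mul_of_nonneg_right h2 (sq_nonneg _)
  nlinarith

/-- The hypothesis on k says |k| ≤ (X - 1) / (2√X) = sinh (ln X / 2); it is kept in squared form to
avoid roots. -/
theorem le_sinh_half_of_log_le {k X K : ℝ} (hX : 1 < X) (hk : 4 * k ^ 2 * X ≤ (X - 1) ^ 2)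
    (hK : Real.log X ≤ K) : k ≤ Real.sinh (K / 2) := by
  have hX0 : 0 < X := by linarith
  have hs : X ≤ Real.exp K := (Real.log_le_iff_le_exp hX0).1 hK
  set E := Real.exp (K / 2) with hE
  have hEE : Real.exp K = E ^ 2 := by rw [hE, ← Real.exp_nat_mul]; congr 1; push_cast; ring
  have hE0 : 0 < E := Real.exp_pos _
  rw [hEE] at hs
  have hmono : (X - 1) ^ 2 * E ^ 2 ≤ (E ^ 2 - 1) ^ 2 * X := by
    -- With Y = E², (Y - 1)²X - (X - 1)²Y = (Y - X)(XY - 1): this is the monotonicity of (X - 1)² /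
    -- X beyond 1.
    have : 0 ≤ (E ^ 2 - X) * (E ^ 2 * X - 1) :=
      mul_nonneg (by linarith) (by nlinarith)
    nlinarith
  have h1 : (2 * k * E) ^ 2 ≤ (E ^ 2 - 1) ^ 2 := by
    have h2 : (4 * k ^ 2 * X) * E ^ 2 ≤ (X - 1) ^ 2 * E ^ 2 :=
      mul_le_mul_of_nonneg_right hk (sq_nonneg E)
    refine le_of_mul_le_mul_right ?_ hX0
    nlinarith
  have h2 : 2 * k * E ≤ E ^ 2 - 1 := (abs_le_of_sq_le_sq' h1 (by linarith)).2
  rw [Real.sinh_eq, Real.exp_neg, ← hE, le_div_iff₀ two_pos]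
  have : (E - E⁻¹) * E = E ^ 2 - 1 := by field_simp
  refine le_of_mul_le_mul_right ?_ hE0
  rw [this]; linarith

theorem sum_sum_mul_sq_sub {ι : Type*} [Fintype ι] (c t : ι → ℝ) :
    ∑ i, ∑ j, c i * c j * (t i - t j) ^ 2 =
      2 * ((∑ i, c i) * (∑ i, c i * t i ^ 2) - (∑ i, c i * t i) ^ 2) := by
  have h : ∀ i j, c i * c j * (t i - t j) ^ 2 = c i * t i ^ 2 * c j + c i * (c j * t j ^ 2)
      - 2 * (c i * t i * (c j * t j)) := fun i j => by ring
  simp only [h, Finset.sum_sub_distrib, Finset.sum_add_distrib, ← Finset.mul_sum,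
    ← Finset.sum_mul]
  ring

/-! ### Positive curves in the quadric -/

/-- A family of pairs of plane vectors that covers the first projective line and is
strictly monotone; the null vectors `segre (A z) (B z)` have negative mutual products. -/
structure IsPositiveLift {Z : Type*} (A B : Z → ℝ × ℝ) : Prop where
  pos : ∀ z w, z ≠ w → 0 < det2 (A z) (A w) * det2 (B z) (B w)
  ne_zero : ∀ z, A z ≠ 0
  surj : ∀ v : ℝ × ℝ, v ≠ 0 → ∃ z, ∃ r : ℝ, r ≠ 0 ∧ A z = r • v

namespace IsPositiveLift

variable {Z : Type*} {A B : Z → ℝ × ℝ}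

theorem det2_ne_zero (h : IsPositiveLift A B) {z w : Z} (hzw : z ≠ w) : det2 (A z) (A w) ≠ 0 :=
  fun h0 => by simpa [h0] using h.pos z w hzw

theorem form_segre_neg (h : IsPositiveLift A B) {z w : Z} (hzw : z ≠ w) :
    form (segre (A z) (B z)) (segre (A w) (B w)) < 0 := by
  rw [form_segre]; have := h.pos z w hzw; linarith

theorem form_segre_nonpos (h : IsPositiveLift A B) (z w : Z) :
    form (segre (A z) (B z)) (segre (A w) (B w)) ≤ 0 := by
  by_cases hzw : z = w
  · subst hzw; simp [form_segre]
  · exact (h.form_segre_neg hzw).le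

/-- A plane that supports the curve and touches it at two points is spacelike. -/
theorem form_self_neg (h : IsPositiveLift A B) {n : R22} (hn : n ≠ 0)
    (hnonneg : ∀ z, 0 ≤ form n (segre (A z) (B z))) {z₁ z₂ : Z} (hz : z₁ ≠ z₂)
    (h₁ : form n (segre (A z₁) (B z₁)) = 0) (h₂ : form n (segre (A z₂) (B z₂)) = 0) :
    form n n < 0 := by
  rw [form_segre_eq_det2] at h₁ h₂
  obtain ⟨r₁, hr₁⟩ := exists_smul_of_det2_eq_zero (h.ne_zero z₁) h₁
  obtain ⟨r₂, hr₂⟩ := exists_smul_of_det2_eq_zero (h.ne_zero z₂) h₂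
  have hpos := h.pos z₁ z₂ hz
  have hd := h.det2_ne_zero hz
  set a₁ := A z₁
  set a₂ := A z₂
  set d := det2 a₁ a₂ with hdd
  have hd' : det2 a₂ a₁ = -d := det2_swap _ _
  have hrr : r₁ * r₂ * d = -form n n * det2 (B z₁) (B z₂) := by
    rw [← det2_twist, hr₁, hr₂, det2_smul_left, det2_smul_right]; ring
  have hD : det2 (B z₁) (B z₂) ≠ 0 := fun h0 => by simp [h0] at hpos
  set D := det2 (B z₁) (B z₂) with hDD
  have twist_comb : ∀ v : ℝ × ℝ, D • twist n v =
      (det2 v (B z₂) * r₁) • a₁ + (-(det2 v (B z₁)) * r₂) • a₂ := by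
    intro v
    have e : D • twist n v =
        det2 v (B z₂) • twist n (B z₁) + (-(det2 v (B z₁))) • twist n (B z₂) := by
      ext <;> simp [twist, det2, hDD] <;> ring
    rw [e, hr₁, hr₂, smul_smul, smul_smul]
  -- The curve points over a₁ + a₂ and a₁ - a₂ lie in the two different arcs between the contact
  -- points. Nonnegativity of n at them compares positive multiples of r₁ and r₂ in opposite
  -- directions, so r₁ and r₂ have the same sign or both vanish.
  have key : ∀ s : ℝ, s ^ 2 = 1 →
      ∃ σ τ : ℝ, 0 < σ ∧ 0 < τ ∧ 0 ≤ (τ * r₂ - σ * r₁) * (s * D) := by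
    intro s hs2
    have hs : s ≠ 0 := by rintro rfl; norm_num at hs2
    have hv : a₁ + s • a₂ ≠ 0 := by
      intro h0
      have := congrArg (det2 a₁) h0
      rw [det2_add_right, det2_smul_right, det2_self] at this
      have h1 : s * d = 0 := by rw [hdd]; simpa [det2] using this
      exact (mul_ne_zero hs hd) h1
    obtain ⟨z, ρ, hρ, hA⟩ := h.surj _ hv
    have e₁ : det2 (A z) a₁ = -(ρ * s * d) := by
      rw [hA, det2_smul_left, det2_add_left, det2_smul_left, det2_self, hd']; ring
    have e₂ : det2 (A z) a₂ = ρ * d := by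
      rw [hA, det2_smul_left, det2_add_left, det2_smul_left, det2_self]; ring
    have hz₁ : z ≠ z₁ := by
      rintro rfl
      exact neg_ne_zero.2 (mul_ne_zero (mul_ne_zero hρ hs) hd) (e₁.symm.trans (det2_self _))
    have hz₂ : z ≠ z₂ := by
      rintro rfl
      exact (mul_ne_zero hρ hd) (e₂.symm.trans (det2_self _))
    have p₁ := h.pos z z₁ hz₁
    have p₂ := h.pos z z₂ hz₂
    change 0 < det2 (A z) a₁ * _ at p₁
    change 0 < det2 (A z) a₂ * _ at p₂
    rw [e₁] at p₁
    rw [e₂] at p₂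
    have hp := hnonneg z
    refine ⟨ρ * d * det2 (B z) (B z₂), -(ρ * s * d) * det2 (B z) (B z₁), p₂, p₁, ?_⟩
    have hform : D * form n (segre (A z) (B z)) =
        ρ * (-(det2 (B z) (B z₁)) * r₂ - s * (det2 (B z) (B z₂) * r₁)) * d := by
      rw [form_segre_eq_det2, ← det2_smul_right, twist_comb, hA, det2_smul_left, det2_add_left,
        det2_smul_left, det2_add_right, det2_add_right, det2_smul_right, det2_smul_right,
        det2_smul_right, det2_smul_right, det2_self, det2_self, hd']
      ring
    have e : (-(ρ * s * d) * det2 (B z) (B z₁) * r₂ - ρ * d * det2 (B z) (B z₂) * r₁) * (s * D) =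
        D ^ 2 * form n (segre (A z) (B z)) := by
      linear_combination (-D) * hform - ρ * d * D * det2 (B z) (B z₁) * r₂ * hs2
    rw [e]
    positivity
  obtain ⟨σ, τ, hσ, hτ, hst⟩ := key 1 (by norm_num)
  obtain ⟨σ', τ', hσ', hτ', hst'⟩ := key (-1) (by norm_num)
  have hprod : 0 < r₁ * r₂ := by
    have signs : (σ * r₁ ≤ τ * r₂ ∧ τ' * r₂ ≤ σ' * r₁) ∨
        (τ * r₂ ≤ σ * r₁ ∧ σ' * r₁ ≤ τ' * r₂) := by
      rcases lt_or_gt_of_ne hD with hneg | hpos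
      · right; constructor <;> nlinarith
      · left; constructor <;> nlinarith
    rcases lt_trichotomy r₁ 0 with h0 | h0 | h0
    · refine mul_pos_of_neg_of_neg h0 ?_
      rcases signs with ⟨-, h'⟩ | ⟨h', -⟩ <;> nlinarith
    · have hr₂0 : r₂ = 0 := by
        subst h0
        rcases signs with ⟨h', h''⟩ | ⟨h', h''⟩ <;> apply le_antisymm <;> nlinarith
      refine absurd ?_ hn
      have tz : ∀ v, twist n v = 0 := by
        intro v
        have := twist_comb v
        rw [h0, hr₂0] at this
        simpa [hD] using this
      have h10 := tz (1, 0)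
      have h01 := tz (0, 1)
      simp only [twist, Prod.mk_eq_zero] at h10 h01
      ext i
      fin_cases i <;> simp <;> linarith [h10.1, h10.2, h01.1, h01.2]
    · refine mul_pos h0 ?_
      rcases signs with ⟨h', -⟩ | ⟨-, h'⟩ <;> nlinarith
  have : 0 < -form n n * (d * D) := by
    have e : -form n n * (d * D) = r₁ * r₂ * d ^ 2 := by linear_combination -d * hrr
    rw [e]; positivity
  linarith [(pos_iff_pos_of_mul_pos this).2 hpos]

/-- The cross-ratio estimate: `p` is a point of the support plane dual to `n`, in the convex hull
of the points where the plane touches the curve, and some point of the curve is separated from `p`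
by a plane orthogonal to the geodesic from `p` in the direction `n`, at distance `arctan k`. -/
theorem le_sinh (h : IsPositiveLift A B) {K : ℝ}
    (hK : ∀ z₁ z₂ z₃ z₄, vectorCrossRatio (A z₁) (A z₂) (A z₃) (A z₄) = -1 →
      |Real.log (abs (vectorCrossRatio (B z₁) (B z₂) (B z₃) (B z₄)))| ≤ K)
    {n p : R22} {ι : Type*} [Fintype ι] {w : ι → ℝ} {z : ι → Z} (hw : ∀ i, 0 < w i)
    (hp : p = ∑ i, w i • segre (A (z i)) (B (z i))) (hpp : form p p < 0)
    (hn : form n n = form p p) (hnonneg : ∀ z, 0 ≤ form n (segre (A z) (B z)))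
    (hz : ∀ i, form n (segre (A (z i)) (B (z i))) = 0) {k : ℝ} (hk : 0 < k) {x : Z}
    (hfx : 0 < form n (segre (A x) (B x)))
    (hx : k * -form p (segre (A x) (B x)) ≤ form n (segre (A x) (B x))) :
    k ≤ Real.sinh (K / 2) := by
  obtain ⟨N, hN⟩ : ∃ N, N = -form n n := ⟨_, rfl⟩
  have hN0 : 0 < N := by rw [hN, hn]; linarith
  have htw : ∀ b d, det2 (twist n b) (twist n d) = N * det2 b d := by
    intro b d; rw [det2_twist, hN]
  have hpos : ∀ y z, y ≠ z → 0 < det2 (A y) (A z) * det2 (twist n (B y)) (twist n (B z)) := by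
    intro y z hyz
    rw [htw]
    have := mul_pos hN0 (h.pos y z hyz)
    linarith
  have hform : ∀ y z, N * form (segre (A y) (B y)) (segre (A z) (B z)) =
      -2 * (det2 (A y) (A z) * det2 (twist n (B y)) (twist n (B z))) := by
    intro y z; rw [form_segre, htw]; ring
  have hr : ∀ i, ∃ r : ℝ, twist n (B (z i)) = r • A (z i) := fun i =>
    exists_smul_of_det2_eq_zero (h.ne_zero _) (by rw [← form_segre_eq_det2]; exact hz i)
  choose r hr using hr
  have hzx : ∀ i, z i ≠ x := by
    rintro i rfl; exact hfx.ne' (hz i)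
  rw [form_segre_eq_det2] at hfx
  obtain ⟨η, hη⟩ : ∃ η, η = det2 (A x) (twist n (B x)) := ⟨_, rfl⟩
  rw [form_segre_eq_det2 n, ← hη] at hx
  rw [← hη] at hfx
  obtain ⟨e, he⟩ : ∃ e, e = η⁻¹ • twist n (B x) := ⟨_, rfl⟩
  have hex : det2 (A x) e = 1 := by
    rw [he, det2_smul_right, ← hη]; field_simp
  have hye : twist n (B x) = η • e := by rw [he, smul_smul, mul_inv_cancel₀ hfx.ne', one_smul]
  have expand : ∀ v w, det2 v w = det2 v e * det2 (A x) w - det2 (A x) v * det2 w e := by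
    intro v w; rw [← det2_plucker, hex, mul_one]
  obtain ⟨α, hα⟩ : ∃ α : ι → ℝ, ∀ i, α i = det2 (A x) (A (z i)) := ⟨_, fun _ => rfl⟩
  have hα0 : ∀ i, α i ≠ 0 := fun i => by rw [hα]; exact h.det2_ne_zero (hzx i).symm
  have hsign : ∀ i, r i * α i * det2 (A (z i)) e < 0 := by
    intro i
    have := hpos (z i) x (hzx i)
    rw [hr, hye, det2_smul_left, det2_smul_right, det2_swap _ (A x), ← hα] at this
    have h' : 0 < η * -(r i * α i * det2 (A (z i)) e) := by linarith
    linarith [(pos_iff_pos_of_mul_pos h').1 hfx]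
  -- Monotonicity of the curve, applied to two fixed points of the twisted map, gives their
  -- multipliers a common sign κ.
  have hrr : ∀ i j, 0 < r i * r j := by
    intro i j
    by_cases hij : z i = z j
    · have : r i * α i = r j * α j := by
        rw [hα, hα, ← det2_smul_right, ← det2_smul_right, ← hr, ← hr, hij]
      have hαα : α i = α j := by rw [hα, hα, hij]
      rw [hαα] at this
      rw [mul_right_cancel₀ (hα0 j) this]
      refine mul_self_pos.2 fun h0 => ?_
      simpa [h0] using hsign j
    · have := hpos _ _ hij
      rw [hr, hr, det2_smul_left, det2_smul_right] at this
      have h' : 0 < r i * r j * det2 (A (z i)) (A (z j)) ^ 2 := by linarith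
      exact (pos_iff_pos_of_mul_pos h').2 (by have := h.det2_ne_zero hij; positivity)
  have hne : Nonempty ι := by
    by_contra hι
    rw [not_nonempty_iff] at hι
    rw [hp] at hpp
    simp [form] at hpp
  obtain ⟨i₀⟩ := hne
  obtain ⟨κ, hκ, hκr⟩ : ∃ κ : ℝ, κ ^ 2 = 1 ∧ ∀ i, 0 < κ * r i := by
    rcases lt_or_ge (r i₀) 0 with h0 | h0
    · exact ⟨-1, by norm_num, fun i => by nlinarith [hrr i i₀]⟩
    · exact ⟨1, by norm_num, fun i => by nlinarith [hrr i i₀]⟩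
  -- The affine coordinate with A x at infinity and the twisted image e of x at 0; the factor κ
  -- orients it so that all contact points are negative.
  obtain ⟨t, ht⟩ : ∃ t : ι → ℝ, ∀ i, det2 (A (z i)) e = κ * t i * α i :=
    ⟨fun i => κ * det2 (A (z i)) e / α i, fun i => by
      have := hα0 i
      field_simp
      linear_combination -det2 (A (z i)) e * hκ⟩
  have ht0 : ∀ i, t i < 0 := by
    intro i
    have h1 := hsign i
    rw [ht] at h1
    have h2 : 0 < (κ * r i * α i ^ 2) * -t i := by linarith
    have h3 : 0 < κ * r i * α i ^ 2 := mul_pos (hκr i) (by have := hα0 i; positivity)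
    linarith [(pos_iff_pos_of_mul_pos h2).1 h3]
  have haa : ∀ i j, det2 (A (z i)) (A (z j)) = κ * α i * α j * (t i - t j) := by
    intro i j; rw [expand, ht, ht, ← hα, ← hα]; ring
  -- These weights turn ⟨p,p⟩ into a variance and ⟨p, x⟩ into η times a first moment.
  obtain ⟨c, hc⟩ : ∃ c : ι → ℝ, ∀ i, N * c i = 2 * κ * r i * w i * α i ^ 2 :=
    ⟨fun i => 2 * κ * r i * w i * α i ^ 2 / N, fun i => by field_simp⟩
  have hc0 : ∀ i, 0 < c i := by
    intro i
    have h1 : 0 < N * c i := by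
      rw [hc, show 2 * κ * r i * w i * α i ^ 2 = 2 * (κ * r i) * w i * α i ^ 2 by ring]
      have := hα0 i; have := hw i; have := hκr i
      positivity
    exact (pos_iff_pos_of_mul_pos h1).1 hN0
  have hvar : ∑ i, ∑ j, c i * c j * (t i - t j) ^ 2 = 2 := by
    have e1 : form p p = ∑ i, ∑ j, w i * (w j * form (segre (A (z i)) (B (z i)))
        (segre (A (z j)) (B (z j)))) := by
      conv_lhs => rw [hp, form_sum_right]
      refine Finset.sum_congr rfl fun i _ => ?_
      rw [form_comm, form_sum_right, Finset.mul_sum]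
    have e2 : ∀ i j, N ^ 2 * (c i * c j * (t i - t j) ^ 2) =
        -(2 * N) * (w i * (w j * form (segre (A (z i)) (B (z i)))
        (segre (A (z j)) (B (z j))))) := by
      intro i j
      have h1 := hform (z i) (z j)
      rw [hr, hr, det2_smul_left, det2_smul_right, haa] at h1
      linear_combination (N * c j * (t i - t j) ^ 2) * hc i +
        (2 * κ * r i * w i * α i ^ 2 * (t i - t j) ^ 2) * hc j + 2 * w i * w j * h1
    have e3 : N ^ 2 * ∑ i, ∑ j, c i * c j * (t i - t j) ^ 2 = -(2 * N) * form p p := by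
      rw [e1]; simp only [Finset.mul_sum, e2]
    have e4 : form p p = -N := by rw [hN, hn]; ring
    rw [e4] at e3
    refine mul_left_cancel₀ (pow_ne_zero 2 hN0.ne') ?_
    linarith
  rw [sum_sum_mul_sq_sub] at hvar
  have hlin : form p (segre (A x) (B x)) = η * ∑ i, c i * t i := by
    rw [hp, form_comm, form_sum_right, Finset.mul_sum]
    refine Finset.sum_congr rfl fun i _ => ?_
    have h1 := hform x (z i)
    rw [hr, hye, det2_smul_left, det2_smul_right, det2_swap e, ht, ← hα] at h1
    refine mul_left_cancel₀ hN0.ne' ?_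
    linear_combination w i * h1 - η * t i * hc i
  obtain ⟨S₀, hS₀⟩ : ∃ S, S = ∑ i, c i := ⟨_, rfl⟩
  obtain ⟨S₁, hS₁⟩ : ∃ S, S = ∑ i, c i * t i := ⟨_, rfl⟩
  obtain ⟨S₂, hS₂⟩ : ∃ S, S = ∑ i, c i * t i ^ 2 := ⟨_, rfl⟩
  rw [← hS₀, ← hS₁, ← hS₂] at hvar
  have hS₀pos : 0 < S₀ := by
    rw [hS₀]; exact Finset.sum_pos (fun i _ => hc0 i) ⟨i₀, Finset.mem_univ _⟩
  have hS₁neg : S₁ < 0 := by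
    rw [hS₁]
    exact Finset.sum_neg (fun i _ => mul_neg_of_pos_of_neg (hc0 i) (ht0 i)) ⟨i₀, Finset.mem_univ _⟩
  have hkT : k * -S₁ ≤ 1 := by
    rw [hlin, ← hS₁] at hx
    have : η * (k * -S₁) ≤ η * 1 := by linarith
    exact le_of_mul_le_mul_left this hfx
  -- The centred values S₀ t - S₁ have weighted variance one because S₀ S₂ - S₁² = 1.
  obtain ⟨i, j, hij, huj, hui⟩ := exists_mul_le_neg_one c (fun i => S₀ * t i - S₁) hc0
    (hS₀ ▸ hS₀pos)
    (by
      have : ∀ i, c i * (S₀ * t i - S₁) = S₀ * (c i * t i) - S₁ * c i := fun i => by ring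
      simp only [this, Finset.sum_sub_distrib, ← Finset.mul_sum, ← hS₀, ← hS₁]
      ring)
    (by
      have : ∀ i, c i * (S₀ * t i - S₁) ^ 2 =
          S₀ ^ 2 * (c i * t i ^ 2) - 2 * S₀ * S₁ * (c i * t i) + S₁ ^ 2 * c i := fun i => by ring
      simp only [this, Finset.sum_sub_distrib, Finset.sum_add_distrib, ← Finset.mul_sum, ← hS₀,
        ← hS₁, ← hS₂]
      linear_combination S₀ / 2 * hvar)
  have htij : t j < t i := by
    by_contra hcon
    push Not at hcon
    nlinarith [mul_le_mul_of_nonneg_left hcon hS₀pos.le]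
  have hest := four_mul_sq_mul_le (k := k) (T := -S₁) (M := S₀ * t i - S₁) (m := -(S₀ * t j - S₁))
    (by linarith) hk hkT (by linarith)
  have hX : 4 * k ^ 2 * (t j / t i) ≤ (t j / t i - 1) ^ 2 := by
    have hti := ht0 i
    have h1 : S₀ ^ 2 * (4 * k ^ 2 * (t j * t i)) ≤ S₀ ^ 2 * (t j - t i) ^ 2 := by
      nlinarith
    have h2 := le_of_mul_le_mul_left h1 (by positivity)
    have hti2 : 0 < t i ^ 2 := by have := hti.ne; positivity
    refine le_of_mul_le_mul_right ?_ hti2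
    have e1 : 4 * k ^ 2 * (t j / t i) * t i ^ 2 = 4 * k ^ 2 * (t j * t i) := by
      field_simp [hti.ne]
    have e2 : (t j / t i - 1) ^ 2 * t i ^ 2 = (t j - t i) ^ 2 := by
      field_simp [hti.ne]
    rw [e1, e2]; exact h2
  have hX1 : 1 < t j / t i := by rw [one_lt_div_of_neg (ht0 i)]; exact htij
  refine le_sinh_half_of_log_le hX1 hX ?_
  -- the fourth point of the harmonic quadruple
  have hαi := hα0 i
  have hαj := hα0 j
  obtain ⟨v, hv⟩ : ∃ v, v = (α i)⁻¹ • A (z i) + (α j)⁻¹ • A (z j) := ⟨_, rfl⟩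
  have hxv : det2 (A x) v = 2 := by
    rw [hv, det2_add_right, det2_smul_right, det2_smul_right, ← hα, ← hα]
    field_simp; norm_num
  have hve : det2 v e = κ * (t i + t j) := by
    rw [hv, det2_add_left, det2_smul_left, det2_smul_left, ht, ht]
    field_simp
  have hv0 : v ≠ 0 := by rintro rfl; simp [det2] at hxv
  obtain ⟨y, ρ, hρ, hy⟩ := h.surj v hv0
  -- y is the midpoint (t i + t j) / 2, and Q / P is the coordinate of its twisted image. Both signs
  -- are settled below: P > 0 and t j < Q / P < t i.
  obtain ⟨P, hP⟩ : ∃ P, P = ρ * κ * det2 (A x) (twist n (B y)) := ⟨_, rfl⟩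
  obtain ⟨Q, hQ⟩ : ∃ Q, Q = ρ * det2 (twist n (B y)) e := ⟨_, rfl⟩
  have hκ0 : κ ≠ 0 := by rintro rfl; norm_num at hκ
  -- Support of the plane at y: its image does not lie above the midpoint.
  have hf : 2 * Q ≤ (t i + t j) * P := by
    have := hnonneg y
    rw [form_segre_eq_det2, hy, det2_smul_left, expand, hve, hxv] at this
    rw [hP, hQ]; linarith
  have hyA : ∀ l, det2 (A y) (A (z l)) = ρ * κ * α l * (t i + t j - 2 * t l) := by
    intro l
    rw [hy, det2_smul_left, expand, hve, hxv, ht, ← hα]; ring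
  have hyB : ∀ l, ρ * det2 (twist n (B y)) (twist n (B (z l))) = r l * α l * (Q - P * t l) := by
    intro l
    rw [hr, det2_smul_right, expand, ht, ← hα, hP, hQ]; ring
  have hsep : ∀ l, t i + t j - 2 * t l ≠ 0 → 0 < (t i + t j - 2 * t l) * (Q - P * t l) := by
    intro l hl
    have hyl : y ≠ z l := by
      rintro rfl
      have := hyA l
      rw [det2_self] at this
      have hαl := hα0 l
      exact (mul_ne_zero (mul_ne_zero (mul_ne_zero hρ hκ0) hαl) hl) this.symm
    have h1 := hpos y (z l) hyl
    rw [hyA] at h1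
    have h2 : 0 < (κ * r l * α l ^ 2) * ((t i + t j - 2 * t l) * (Q - P * t l)) := by
      have := hyB l
      calc 0 < _ := h1
        _ = _ := by linear_combination κ * α l * (t i + t j - 2 * t l) * this
    have h3 : 0 < κ * r l * α l ^ 2 := mul_pos (hκr l) (by have := hα0 l; positivity)
    exact (pos_iff_pos_of_mul_pos h2).1 h3
  have hi := hsep i (by linarith)
  have hj := hsep j (by linarith)
  have hi' : 0 < P * t i - Q := by
    have : 0 < (t i - t j) * (P * t i - Q) := by linarith
    exact (pos_iff_pos_of_mul_pos this).1 (by linarith)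
  have hj' : 0 < Q - P * t j := by
    have : 0 < (t i - t j) * (Q - P * t j) := by linarith
    exact (pos_iff_pos_of_mul_pos this).1 (by linarith)
  have hri : r i ≠ 0 := fun h0 => by simpa [h0] using hκr i
  have hrj : r j ≠ 0 := fun h0 => by simpa [h0] using hκr j
  have hharm : vectorCrossRatio (A (z i)) (A x) (A (z j)) (A y) = -1 := by
    have hd : t i - t j ≠ 0 := by linarith
    rw [vectorCrossRatio, det2_swap (A (z j)) (A x), det2_swap (A (z j)) (A y), hyA, hyA, ← hα,
      ← hα, div_eq_iff]
    · ring
    · have : t i + t j - 2 * t j ≠ 0 := by linarith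
      simp only [ne_eq, mul_eq_zero, neg_eq_zero, not_or]
      exact ⟨hαi, ⟨⟨hρ, hκ0⟩, hαj⟩, this⟩
  have hB : vectorCrossRatio (B (z i)) (B x) (B (z j)) (B y) =
      -(t j / t i * ((P * t i - Q) / (Q - P * t j))) := by
    have h1 : vectorCrossRatio (B (z i)) (B x) (B (z j)) (B y) =
        vectorCrossRatio (twist n (B (z i))) (twist n (B x)) (twist n (B (z j)))
          (ρ • twist n (B y)) := by
      rw [← one_smul ℝ (twist n (B (z i))), ← one_smul ℝ (twist n (B x)),
        ← one_smul ℝ (twist n (B (z j))),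
        vectorCrossRatio_smul one_ne_zero one_ne_zero one_ne_zero hρ]
      simp only [vectorCrossRatio, htw]
      rw [show N * det2 (B y) (B (z i)) * (N * det2 (B (z j)) (B x)) =
        N ^ 2 * (det2 (B y) (B (z i)) * det2 (B (z j)) (B x)) by ring,
        show N * det2 (B x) (B (z i)) * (N * det2 (B (z j)) (B y)) =
        N ^ 2 * (det2 (B x) (B (z i)) * det2 (B (z j)) (B y)) by ring,
        mul_div_mul_left _ _ (by positivity)]
    have hzx' : ∀ l, det2 (twist n (B (z l))) (twist n (B x)) = r l * η * (κ * t l * α l) := by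
      intro l; rw [hr, hye, det2_smul_left, det2_smul_right, ht]; ring
    rw [h1, vectorCrossRatio, det2_smul_left, det2_smul_right,
      det2_swap (twist n (B (z j))) (twist n (B y)), det2_swap (twist n (B x)), mul_neg, hyB, hyB,
      hzx', hzx']
    have := (ht0 i).ne
    have := hfx.ne'
    have := hj'.ne'
    field_simp
    ring
  have hKq := hK _ _ _ _ hharm
  rw [hB, abs_neg] at hKq
  -- If y were fixed, the second factor would be 1; moving its image towards t j only increases it.
  have hge : t j / t i ≤ t j / t i * ((P * t i - Q) / (Q - P * t j)) := by
    refine le_mul_of_one_le_right (by linarith) ?_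
    rw [one_le_div hj']; linarith
  rw [abs_of_pos (zero_lt_one.trans (hX1.trans_le hge))] at hKq
  exact (Real.log_le_log (by linarith) hge).trans ((le_abs_self _).trans hKq)

end IsPositiveLift

/-! ### Exit points of convex hulls -/

/-- In finite dimension, the convex hull of a compact set is compact. -/
theorem isCompact_convexHull_of_isCompact {E : Type*} [NormedAddCommGroup E] [NormedSpace ℝ E]
    [FiniteDimensional ℝ E] {T : Set E} (hT : IsCompact T) : IsCompact (convexHull ℝ T) := by
  set d := Module.finrank ℝ E + 1
  set F : (Fin d → ℝ) × (Fin d → E) → E := fun x => ∑ i, x.1 i • x.2 i with hF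
  have hFc : Continuous F := by fun_prop
  have hcomp : IsCompact (stdSimplex ℝ (Fin d) ×ˢ (univ.pi fun _ : Fin d => T)) :=
    (isCompact_stdSimplex ℝ (Fin d)).prod (isCompact_univ_pi fun _ => hT)
  convert hcomp.image hFc using 1
  refine Subset.antisymm (fun x hx => ?_) ?_
  -- Carathéodory: affine independence bounds the number of points by d; the unused slots get weight
  -- 0 and an arbitrary point of T.
  · obtain ⟨ι, hι, z, w, hz, hind, hw, hw1, hsum⟩ := eq_pos_convex_span_of_mem_convexHull hx
    obtain ⟨e⟩ : Nonempty (ι ↪ Fin d) := by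
      rw [Function.Embedding.nonempty_iff_card_le, Fintype.card_fin]
      exact hind.card_le_finrank_succ.trans (Nat.succ_le_succ (Submodule.finrank_le _))
    have hx₀ : T.Nonempty := convexHull_nonempty_iff.1 ⟨x, hx⟩
    obtain ⟨s₀, hs₀⟩ := hx₀
    have hwe : ∀ i ∉ range e, Function.extend e w 0 i = 0 := fun i hi =>
      Function.extend_apply' _ _ _ hi
    have hwe' : ∀ i, Function.extend e w 0 (e i) = w i := fun i => e.injective.extend_apply _ _ _
    have hze : ∀ i, Function.extend e z (fun _ => s₀) (e i) = z i := fun i =>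
      e.injective.extend_apply _ _ _
    refine ⟨(Function.extend e w 0, Function.extend e z fun _ => s₀), ⟨⟨fun i => ?_, ?_⟩,
      fun i _ => ?_⟩, ?_⟩
    · by_cases hi : i ∈ range e
      · obtain ⟨j, rfl⟩ := hi
        change 0 ≤ Function.extend e w 0 (e j)
        rw [hwe']; exact (hw j).le
      · exact (hwe i hi).ge
    · rw [← hw1]
      exact (Fintype.sum_of_injective e e.injective _ _ hwe fun i => (hwe' i).symm).symm
    · change Function.extend e z (fun _ => s₀) i ∈ T
      by_cases hi : i ∈ range e
      · obtain ⟨j, rfl⟩ := hi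
        rw [hze]; exact hz (mem_range_self j)
      · rw [Function.extend_apply' _ _ _ hi]; exact hs₀
    · rw [← hsum]
      refine (Fintype.sum_of_injective e e.injective _ _ (fun i hi => ?_) fun i => ?_).symm
      · simp only [hwe i hi, zero_smul]
      · simp only [hwe', hze]
  · rintro _ ⟨⟨w, z⟩, ⟨hw, hz⟩, rfl⟩
    exact mem_convexHull_of_exists_fintype w z hw.1 hw.2 (fun i => hz i (mem_univ i)) rfl

theorem form_nonneg_of_mem_convexHull {n x : R22} {T : Set R22} (h : ∀ s ∈ T, 0 ≤ form n s)
    (hx : x ∈ convexHull ℝ T) : 0 ≤ form n x :=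
  convexHull_min (t := {y | 0 ≤ formLin n y}) h
    ((convex_Ici (0 : ℝ)).linear_preimage (formLin n)) hx

theorem form_neg_of_mem_convexHull {n x : R22} {T : Set R22} (h : ∀ s ∈ T, form n s < 0)
    (hx : x ∈ convexHull ℝ T) : form n x < 0 :=
  convexHull_min (t := {y | formLin n y < 0}) h
    ((convex_Iio (0 : ℝ)).linear_preimage (formLin n)) hx

theorem form_nonpos_of_mem_convexHull {T : Set R22} (h : ∀ s ∈ T, ∀ t ∈ T, form s t ≤ 0)
    {x y : R22} (hx : x ∈ convexHull ℝ T) (hy : y ∈ convexHull ℝ T) : form x y ≤ 0 := by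
  have h1 : ∀ s ∈ T, form s y ≤ 0 := fun s hs => by
    have := form_nonneg_of_mem_convexHull (n := (-1 : ℝ) • s) (T := T)
      (fun t ht => by rw [form_smul_left]; linarith [h s hs t ht]) hy
    rw [form_smul_left] at this
    linarith
  have := form_nonneg_of_mem_convexHull (n := (-1 : ℝ) • y) (T := T)
    (fun t ht => by rw [form_smul_left, form_comm]; linarith [h1 t ht]) hx
  rw [form_smul_left, form_comm] at this
  linarith

/-- A point of the affine hyperplane `form m = 1` outside of the convex hull of a compact subset is
separated from it by a linear functional. -/
theorem exists_form_neg_of_notMem {m x : R22} {T : Set R22} (hT : IsCompact T)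
    (hm : ∀ s ∈ T, form m s = 1) (hmx : form m x = 1) (hx : x ∉ convexHull ℝ T) :
    ∃ n, (∀ s ∈ T, 0 < form n s) ∧ form n x < 0 := by
  obtain ⟨g, u, hgx, hg⟩ := geometric_hahn_banach_point_closed (convex_convexHull ℝ T)
    (isCompact_convexHull_of_isCompact hT).isClosed hx
  obtain ⟨n, hn⟩ := exists_form_eq (g : R22 →ₗ[ℝ] ℝ)
  have hn' : ∀ y, g y = form n y := hn
  -- On the hyperplane `form m = 1` the constant u agrees with the linear functional of `u • m`.
  refine ⟨n - u • m, fun s hs => ?_, ?_⟩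
  · rw [form_sub_left, form_smul_left, hm s hs, ← hn']
    linarith [hg s (subset_convexHull ℝ T hs)]
  · rw [form_sub_left, form_smul_left, hmx, ← hn']
    linarith

/-- The ray from `Q` through `P` leaves the convex hull at a point of a support plane. -/
theorem exists_exit {m P Q : R22} {T : Set R22} (hT : IsCompact T) (hm : ∀ s ∈ T, form m s = 1)
    (hP : P ∈ convexHull ℝ T) (hmP : form m P = 1) (hmQ : form m Q = 1) (hPQ : P ≠ Q) :
    ∃ t : ℝ, 0 ≤ t ∧ P + t • (P - Q) ∈ convexHull ℝ T ∧
      ∃ n, n ≠ 0 ∧ (∀ s ∈ T, 0 ≤ form n s) ∧ form n (P + t • (P - Q)) = 0 := by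
  set C := convexHull ℝ T with hC
  have hCc : IsCompact C := isCompact_convexHull_of_isCompact hT
  set γ : ℝ → R22 := fun t => P + t • (P - Q) with hγ
  have hγc : Continuous γ := by fun_prop
  set I : Set ℝ := {t | 0 ≤ t ∧ γ t ∈ C} with hI
  have hIc : IsClosed I := isClosed_Ici.inter (hCc.isClosed.preimage hγc)
  have h0 : (0 : ℝ) ∈ I := ⟨le_rfl, by simpa [hγ] using hP⟩
  have hIb : BddAbove I := by
    obtain ⟨R, hR⟩ := hCc.isBounded.exists_norm_le
    refine ⟨2 * R / ‖P - Q‖, fun t ht => ?_⟩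
    have hpos : 0 < ‖P - Q‖ := norm_pos_iff.2 (sub_ne_zero.2 hPQ)
    rw [le_div_iff₀ hpos]
    calc t * ‖P - Q‖ = ‖γ t - P‖ := by
          rw [hγ, add_sub_cancel_left, norm_smul, Real.norm_of_nonneg ht.1]
      _ ≤ ‖γ t‖ + ‖P‖ := norm_sub_le _ _
      _ ≤ 2 * R := by linarith [hR _ ht.2, hR _ hP]
  set t₀ := sSup I
  have ht₀ : t₀ ∈ I := hIc.csSup_mem ⟨0, h0⟩ hIb
  -- Points just beyond the exit point are strictly separated from T; a limit of the unit normals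
  -- supports T at the exit point.
  have hsep : ∀ k : ℕ, ∃ n : R22, ‖n‖ = 1 ∧ (∀ s ∈ T, 0 < form n s) ∧
      form n (γ (t₀ + 1 / ((k : ℝ) + 1))) < 0 := by
    intro k
    have hk : (0 : ℝ) < 1 / ((k : ℝ) + 1) := by positivity
    have hnot : γ (t₀ + 1 / ((k : ℝ) + 1)) ∉ C := fun hmem => by
      have := le_csSup hIb (show t₀ + 1 / ((k : ℝ) + 1) ∈ I from ⟨by linarith [ht₀.1], hmem⟩)
      linarith
    obtain ⟨n, hn, hnx⟩ := exists_form_neg_of_notMem hT hm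
      (by rw [hγ, form_add_right, form_smul_right, form_sub_right, hmP, hmQ]; ring) hnot
    have hn0 : n ≠ 0 := by rintro rfl; simp [form] at hnx
    have hpos : 0 < ‖n‖⁻¹ := inv_pos.2 (norm_pos_iff.2 hn0)
    refine ⟨‖n‖⁻¹ • n, norm_smul_inv_norm hn0, fun s hs => ?_, ?_⟩
    · rw [form_smul_left]; exact mul_pos hpos (hn s hs)
    · rw [form_smul_left]; exact mul_neg_of_pos_of_neg hpos hnx
  choose n hn1 hnpos hnneg using hsep
  obtain ⟨n₀, hn₀, ψ, hψ, hlim⟩ := (isCompact_sphere (0 : R22) 1).tendsto_subseq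
    (x := n) (fun k => by simpa using hn1 k)
  have hnonneg : ∀ s ∈ T, 0 ≤ form n₀ s := fun s hs =>
    ge_of_tendsto' ((continuous_form.tendsto (n₀, s)).comp (hlim.prodMk_nhds tendsto_const_nhds))
      fun k => (hnpos (ψ k) s hs).le
  have hle : form n₀ (γ t₀) ≤ 0 := by
    have ht : Filter.Tendsto (fun k : ℕ => t₀ + 1 / ((k : ℝ) + 1)) Filter.atTop (𝓝 t₀) := by
      simpa using tendsto_const_nhds.add (tendsto_one_div_add_atTop_nhds_zero_nat (𝕜 := ℝ))
    have hγt := ((hγc.tendsto t₀).comp ht).comp hψ.tendsto_atTop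
    exact le_of_tendsto' ((continuous_form.tendsto (n₀, γ t₀)).comp (hlim.prodMk_nhds hγt))
      fun k => (hnneg (ψ k)).le
  refine ⟨t₀, ht₀.1, ht₀.2, n₀, ?_, hnonneg,
    le_antisymm hle (form_nonneg_of_mem_convexHull hnonneg ht₀.2)⟩
  rintro rfl
  simp at hn₀

/-! ### Timelike distances in the hull of a positive curve -/

namespace IsPositiveLift

variable {Z : Type*} {A B : Z → ℝ × ℝ}

/-- The estimate of a timelike distance in the convex hull of a positive curve. -/
theorem tan_le_sinh (h : IsPositiveLift A B) {K : ℝ}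
    (hK : ∀ z₁ z₂ z₃ z₄, vectorCrossRatio (A z₁) (A z₂) (A z₃) (A z₄) = -1 →
      |Real.log (abs (vectorCrossRatio (B z₁) (B z₂) (B z₃) (B z₄)))| ≤ K)
    {m : R22} (hm : ∀ z, form m (segre (A z) (B z)) = 1)
    (hT : IsCompact (range fun z => segre (A z) (B z))) {p q : R22} {ℓ a b : ℝ}
    (hpp : form p p = -1) (hqq : form q q = -1) (hpq : form p q = -Real.cos ℓ)
    (hℓ : 0 < ℓ) (hℓ' : ℓ < Real.pi / 2) (ha : form m p = a) (hb : form m q = b)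
    (ha0 : a ≠ 0) (hb0 : b ≠ 0)
    (hP : a⁻¹ • p ∈ convexHull ℝ (range fun z => segre (A z) (B z)))
    (hQ : b⁻¹ • q ∈ convexHull ℝ (range fun z => segre (A z) (B z))) :
    Real.tan ℓ ≤ Real.sinh (K / 2) := by
  set T := range fun z => segre (A z) (B z) with hTdef
  have hcos : 0 < Real.cos ℓ := Real.cos_pos_of_mem_Ioo ⟨by linarith, hℓ'⟩
  have hsin : 0 < Real.sin ℓ := Real.sin_pos_of_pos_of_lt_pi hℓ (by linarith [Real.pi_pos])
  have hsc := Real.sin_sq_add_cos_sq ℓ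
  have hTT : ∀ s ∈ T, ∀ t ∈ T, form s t ≤ 0 := by
    rintro _ ⟨z, rfl⟩ _ ⟨w, rfl⟩; exact h.form_segre_nonpos z w
  have hmT : ∀ s ∈ T, form m s = 1 := by rintro _ ⟨z, rfl⟩; exact hm z
  -- Products in the convex hull are nonpositive and cos ℓ > 0, so p and q have representatives of
  -- the same sign in the chart.
  have hab : 0 < a⁻¹ * b⁻¹ := by
    have h1 := form_nonpos_of_mem_convexHull hTT hP hQ
    rw [form_smul_left, form_smul_right, hpq] at h1
    have h2 : 0 ≤ (a⁻¹ * b⁻¹) * Real.cos ℓ := by linarith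
    exact lt_of_le_of_ne (nonneg_of_mul_nonneg_left h2 hcos) (by positivity)
  have hPQ : a⁻¹ • p ≠ b⁻¹ • q := by
    intro heq
    have h1 := congrArg (form p) heq
    have h2 := congrArg (form q) heq
    rw [form_smul_right, form_smul_right, hpp, hpq] at h1
    rw [form_smul_right, form_smul_right, hqq, form_comm q p, hpq] at h2
    have h3 : b⁻¹ * (Real.sin ℓ) ^ 2 = 0 := by
      linear_combination b⁻¹ * hsc - Real.cos ℓ * h1 + h2
    have : b⁻¹ * (Real.sin ℓ) ^ 2 ≠ 0 := by positivity
    exact this h3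
  obtain ⟨t, ht, hP', n, hn0, hnT, hnP'⟩ := exists_exit (Q := b⁻¹ • q) hT hmT hP
    (by rw [form_smul_right, ha, inv_mul_cancel₀ ha0])
    (by rw [form_smul_right, hb, inv_mul_cancel₀ hb0]) hPQ
  obtain ⟨p', hp'⟩ : ∃ p', p' = a⁻¹ • p + t • (a⁻¹ • p - b⁻¹ • q) := ⟨_, rfl⟩
  rw [← hp'] at hP' hnP'
  obtain ⟨u, hu⟩ : ∃ u, u = (1 + t) * a⁻¹ := ⟨_, rfl⟩
  obtain ⟨s, hs⟩ : ∃ s, s = t * b⁻¹ := ⟨_, rfl⟩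
  have hp'e : p' = u • p - s • q := by rw [hp', hu, hs]; module
  have hu0 : u ≠ 0 := by rw [hu]; positivity
  have hp'p' : form p' p' = -((s - u * Real.cos ℓ) ^ 2 + (u * Real.sin ℓ) ^ 2) := by
    simp only [hp'e, form_sub_left, form_sub_right, form_smul_left, form_smul_right, hpp, hqq, hpq,
      form_comm q p]
    linear_combination u ^ 2 * hsc
  have hp'neg : form p' p' < 0 := by
    rw [hp'p']
    have : 0 < (u * Real.sin ℓ) ^ 2 := by positivity
    nlinarith [sq_nonneg (s - u * Real.cos ℓ)]
  obtain ⟨ι, hι, y, w, hy, -, hw, -, hsum⟩ := eq_pos_convex_span_of_mem_convexHull hP'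
  have hyz : ∀ i, ∃ z, segre (A z) (B z) = y i := fun i => hy (mem_range_self i)
  choose z hz using hyz
  have hsum' : p' = ∑ i, w i • segre (A (z i)) (B (z i)) := by simp only [hz, hsum]
  have hnz : ∀ i, form n (segre (A (z i)) (B (z i))) = 0 := by
    rw [hsum', form_sum_right] at hnP'
    intro i
    have := (Finset.sum_eq_zero_iff_of_nonneg
      (fun i _ => mul_nonneg (hw i).le (hnT _ ⟨z i, rfl⟩))).1 hnP' i (Finset.mem_univ _)
    exact (mul_eq_zero.1 this).resolve_left (hw i).ne'
  have hpσ : ∀ x, form p' (segre (A x) (B x)) =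
      ∑ i, w i * form (segre (A x) (B x)) (segre (A (z i)) (B (z i))) := by
    intro x; rw [form_comm, hsum', form_sum_right]
  have hne : ∀ x, ∃ i, z i ≠ x := by
    intro x
    by_contra hcon
    push Not at hcon
    have h0 : ∀ i, form p' (segre (A (z i)) (B (z i))) = 0 := by
      intro i
      rw [hpσ]
      refine Finset.sum_eq_zero fun j _ => ?_
      rw [hcon i, hcon j, form_segre]; simp
    have : form p' p' = 0 := by
      conv_lhs => rw [hsum', form_sum_right, ← hsum']
      exact Finset.sum_eq_zero fun i _ => by rw [h0, mul_zero]
    exact hp'neg.ne this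
  have hpσneg : ∀ x, form p' (segre (A x) (B x)) < 0 := by
    intro x
    obtain ⟨i, hi⟩ := hne x
    rw [hpσ]
    refine Finset.sum_neg' (fun j _ => mul_nonpos_of_nonneg_of_nonpos (hw j).le
      (h.form_segre_nonpos _ _)) ⟨i, Finset.mem_univ _, mul_neg_of_pos_of_neg (hw i)
      (h.form_segre_neg hi.symm)⟩
  have hnn : form n n < 0 := by
    have hι : ∃ i : ι, True := by
      obtain ⟨x, -⟩ := h.surj (1, 0) (by simp)
      obtain ⟨i, -⟩ := hne x
      exact ⟨i, trivial⟩
    obtain ⟨i, -⟩ := hι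
    obtain ⟨j, hj⟩ := hne (z i)
    exact h.form_self_neg hn0 (fun z => hnT _ ⟨z, rfl⟩) hj (hnz j) (hnz i)
  obtain ⟨r, hr⟩ : ∃ r, r = Real.sqrt (form p' p' / form n n) := ⟨_, rfl⟩
  have hr0 : 0 < r := by rw [hr]; exact Real.sqrt_pos.2 (div_pos_of_neg_of_neg hp'neg hnn)
  have hr2 : r ^ 2 * form n n = form p' p' := by
    rw [hr, Real.sq_sqrt (div_pos_of_neg_of_neg hp'neg hnn).le, div_mul_cancel₀ _ hnn.ne]
  have hN : form (r • n) (r • n) = form p' p' := by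
    rw [form_smul_left, form_smul_right, ← hr2]; ring
  have htan : 0 < Real.tan ℓ := Real.tan_pos_of_pos_of_lt_pi_div_two hℓ hℓ'
  have htan' : Real.tan ℓ * Real.cos ℓ = Real.sin ℓ := Real.tan_mul_cos hcos.ne'
  have hnT' : ∀ z, 0 ≤ form (r • n) (segre (A z) (B z)) := fun z => by
    rw [form_smul_left]; exact mul_nonneg hr0.le (hnT _ ⟨z, rfl⟩)
  have hex : ∃ x, Real.tan ℓ * -form p' (segre (A x) (B x)) ≤
      form (r • n) (segre (A x) (B x)) := by
    by_contra hcon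
    push Not at hcon
    -- Otherwise this functional would be negative on the whole curve, hence at q, against the lower
    -- bound for ⟨n,q⟩ from the Bessel inequality. Prolonging the ray costs nothing: it only adds
    -- the term tan ℓ · t · (b⁻¹)² ≥ 0.
    have h1 : form (r • n + Real.tan ℓ • p') (b⁻¹ • q) < 0 := by
      refine form_neg_of_mem_convexHull ?_ hQ
      rintro _ ⟨x, rfl⟩
      rw [form_add_left, form_smul_left _ p']
      linarith [hcon x]
    have h2 := form_mul_form_le (q := b⁻¹ • q) hp'neg hN
      (by rw [form_smul_right, form_comm, hnP', mul_zero])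
    have h3 : 0 ≤ form (r • n) (b⁻¹ • q) :=
      form_nonneg_of_mem_convexHull (by rintro _ ⟨z, rfl⟩; exact hnT' z) hQ
    rw [form_add_left, form_smul_left _ p'] at h1
    have h4 : form p' (b⁻¹ • q) = b⁻¹ * (s - u * Real.cos ℓ) := by
      rw [hp'e, form_smul_right, form_sub_left, form_smul_left, form_smul_left, hpq, hqq]; ring
    have h5 : form (b⁻¹ • q) (b⁻¹ • q) = -(b⁻¹) ^ 2 := by
      rw [form_smul_left, form_smul_right, hqq]; ring
    rw [h4] at h1 h2
    rw [h5, hp'p'] at h2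
    have h6 : (b⁻¹ * u * Real.sin ℓ) ^ 2 ≤ form (r • n) (b⁻¹ • q) ^ 2 := by nlinarith
    have h7 : b⁻¹ * u * Real.sin ℓ ≤ form (r • n) (b⁻¹ • q) := (abs_le_of_sq_le_sq' h6 h3).2
    have h8 : 0 ≤ Real.tan ℓ * (b⁻¹ * s) := by
      rw [hs]
      have : b⁻¹ * (t * b⁻¹) = t * (b⁻¹) ^ 2 := by ring
      rw [this]; positivity
    have h9 : Real.tan ℓ * (b⁻¹ * (s - u * Real.cos ℓ)) =
        Real.tan ℓ * (b⁻¹ * s) - b⁻¹ * u * Real.sin ℓ := by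
      linear_combination (-(b⁻¹ * u)) * htan'
    linarith
  obtain ⟨x, hx⟩ := hex
  refine h.le_sinh hK hw hsum' hp'neg hN hnT' (fun i => ?_) htan (x := x) ?_ hx
  · rw [form_smul_left, hnz, mul_zero]
  · exact lt_of_lt_of_le (mul_pos htan (neg_pos.2 (hpσneg x))) hx

end IsPositiveLift

/-! ### The graph of an orientation-preserving homeomorphism -/

theorem homCoord_ne_zero (z : OnePoint ℝ) : homCoord z ≠ 0 := by
  rcases z with _ | x <;> simp [homCoord]

theorem exists_homCoord_eq_smul (v : ℝ × ℝ) (hv : v ≠ 0) :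
    ∃ z, ∃ r : ℝ, r ≠ 0 ∧ homCoord z = r • v := by
  by_cases h : v.2 = 0
  · have h1 : v.1 ≠ 0 := fun h1 => hv (Prod.ext h1 h)
    exact ⟨none, v.1⁻¹, inv_ne_zero h1, by ext <;> simp [homCoord, h, h1]⟩
  · refine ⟨some (v.1 / v.2), v.2⁻¹, inv_ne_zero h, ?_⟩
    ext <;> simp [homCoord, h]
    field_simp

theorem diff_ne_zero {a b : OnePoint ℝ} (h : a ≠ b) : diff a b ≠ 0 := by
  intro h0
  apply h
  rcases a with _ | a <;> rcases b with _ | b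
  · rfl
  · simp [diff, det2, homCoord] at h0
  · simp [diff, det2, homCoord] at h0
  · simp only [diff, det2, homCoord] at h0
    congr 1; linarith

theorem diff_swap (a b : OnePoint ℝ) : diff a b = -diff b a := det2_swap _ _

/-- Near every point of the projective line, the homogeneous coordinates have a continuous
representative. -/
theorem exists_continuousAt_smul_homCoord (z₀ : OnePoint ℝ) :
    ∃ r : OnePoint ℝ → ℝ, (∀ z, r z ≠ 0) ∧ ContinuousAt (fun z => r z • homCoord z) z₀ := by
  induction z₀ using OnePoint.rec with
  | infty =>
    classical
    refine ⟨fun z => if (homCoord z).1 = 0 then 1 else (homCoord z).1⁻¹, fun z => ?_, ?_⟩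
    · dsimp only
      split_ifs with h
      · exact one_ne_zero
      · exact inv_ne_zero h
    · rw [OnePoint.continuousAt_infty', Filter.coclosedCompact_eq_cocompact]
      have h : Filter.Tendsto (fun x : ℝ => ((1 : ℝ), x⁻¹)) (Filter.cocompact ℝ) (𝓝 (1, 0)) := by
        rw [← Metric.cobounded_eq_cocompact]
        exact tendsto_const_nhds.prodMk_nhds Filter.tendsto_inv₀_cobounded
      have e : (if (homCoord OnePoint.infty).1 = 0 then (1 : ℝ)
          else (homCoord OnePoint.infty).1⁻¹) • homCoord OnePoint.infty = (1, 0) := by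
        change (if (1 : ℝ) = 0 then (1 : ℝ) else 1⁻¹) • ((1 : ℝ), (0 : ℝ)) = (1, 0)
        simp
      simp only [e]
      refine h.congr' ?_
      have hne : ∀ᶠ x : ℝ in Filter.cocompact ℝ, x ≠ 0 := by
        simpa using (isCompact_singleton (x := (0 : ℝ))).compl_mem_cocompact
      filter_upwards [hne] with x hx
      change _ = (if x = 0 then (1 : ℝ) else x⁻¹) • (x, (1 : ℝ))
      simp [hx]
  | coe x =>
    refine ⟨fun _ => 1, fun _ => one_ne_zero, ?_⟩
    rw [OnePoint.continuousAt_coe]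
    change ContinuousAt (fun y : ℝ => (1 : ℝ) • (y, (1 : ℝ))) x
    fun_prop

theorem continuous_segre : Continuous fun p : (ℝ × ℝ) × (ℝ × ℝ) => segre p.1 p.2 := by
  refine continuous_pi fun i => ?_
  fin_cases i <;> simp [segre] <;> fun_prop

variable {φ : OnePoint ℝ ≃ₜ OnePoint ℝ}

/-- A null vector that represents the point of the graph over `z`. -/
def graphVector (φ : OnePoint ℝ ≃ₜ OnePoint ℝ) (z : OnePoint ℝ) : R22 :=
  segre (homCoord z) (homCoord (φ z))

theorem form_graphVector (a b : OnePoint ℝ) : form (graphVector φ a) (graphVector φ b) =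
    -2 * (diff a b * diff (φ a) (φ b)) := by
  rw [graphVector, graphVector, form_segre, diff, diff]; ring

/-- A negatively ordered triple becomes positive after a transposition, so φ preserves both orders.
This is a cocycle condition on signs: one sign per point makes all pairwise products agree. -/
theorem OrientationPreserving.mul_pos (h : OrientationPreserving φ) {a b c : OnePoint ℝ}
    (hab : a ≠ b) (hbc : b ≠ c) (hca : c ≠ a) :
    0 < (diff a b * diff (φ a) (φ b)) * (diff b c * diff (φ b) (φ c)) *
      (diff c a * diff (φ c) (φ a)) := by
  have h0 : diff a b * diff b c * diff c a ≠ 0 :=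
    mul_ne_zero (mul_ne_zero (diff_ne_zero hab) (diff_ne_zero hbc)) (diff_ne_zero hca)
  rcases lt_or_gt_of_ne h0 with hneg | hpos
  · have h1 : PosCyclic a c b := by
      rw [PosCyclic, diff_swap a c, diff_swap c b, diff_swap b a]; linarith
    have h2 := h _ _ _ h1
    rw [PosCyclic] at h1 h2
    have := _root_.mul_pos h1 h2
    rw [diff_swap a c, diff_swap c b, diff_swap b a, diff_swap (φ a) (φ c),
      diff_swap (φ c) (φ b), diff_swap (φ b) (φ a)] at this
    linarith
  · have h2 := h _ _ _ hpos
    rw [PosCyclic] at h2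
    have := _root_.mul_pos hpos h2
    linarith

/-- A vector dual to a plane disjoint from the graph. -/
theorem OrientationPreserving.exists_form_ne_zero (h : OrientationPreserving φ) :
    ∃ m, (∀ z, form m (graphVector φ z) ≠ 0) ∧ ∀ z w, z ≠ w →
      form (graphVector φ z) (graphVector φ w) *
        (form m (graphVector φ z) * form m (graphVector φ w)) < 0 := by
  obtain ⟨D, hD⟩ : ∃ D : OnePoint ℝ → OnePoint ℝ → ℝ,
      ∀ a b, D a b = diff a b * diff (φ a) (φ b) := ⟨_, fun _ _ => rfl⟩
  have hDs : ∀ a b, D a b = D b a := fun a b => by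
    rw [hD, hD, diff_swap a, diff_swap (φ a)]; ring
  have hD0 : ∀ a, D a a = 0 := fun a => by rw [hD, diff, det2_self, zero_mul]
  have hDne : ∀ {a b}, a ≠ b → D a b ≠ 0 := fun {a b} hab => by
    rw [hD]; exact mul_ne_zero (diff_ne_zero hab) (diff_ne_zero (φ.injective.ne hab))
  have htri : ∀ {a b c}, a ≠ b → b ≠ c → c ≠ a → 0 < D a b * D b c * D c a :=
    fun {a b c} hab hbc hca => by
      rw [hD, hD, hD]; exact h.mul_pos hab hbc hca
  obtain ⟨o, ho⟩ : ∃ o : OnePoint ℝ, o ≠ OnePoint.infty := ⟨_, OnePoint.coe_ne_infty 0⟩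
  set ω : OnePoint ℝ := OnePoint.infty
  -- The product with z has the sign of -D ω z, since by the triple condition D ω o · D o z does not
  -- oppose D ω z. The second summand keeps it nonzero at ω itself.
  set m : R22 := graphVector φ ω + D ω o • graphVector φ o with hm
  have hmz : ∀ z, form m (graphVector φ z) = -2 * (D ω z + D ω o * D o z) := by
    intro z
    rw [hm, form_add_left, form_smul_left, form_graphVector, form_graphVector, hD, hD, hD]; ring
  have hdo := hDne ho.symm
  have hω : form m (graphVector φ ω) < 0 := by
    rw [hmz, hD0, hDs o ω]
    have : 0 < D ω o * D ω o := mul_self_pos.2 hdo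
    linarith
  have hz : ∀ z, z ≠ ω → D ω z * form m (graphVector φ z) < 0 := by
    intro z hzω
    rw [hmz]
    have h1 : 0 < D ω z * D ω z := mul_self_pos.2 (hDne hzω.symm)
    have h2 : 0 ≤ D ω z * (D ω o * D o z) := by
      by_cases hzo : z = o
      · rw [hzo, hD0]; simp
      · have := htri (a := ω) (b := o) (c := z) ho.symm (Ne.symm hzo) hzω
        rw [hDs z ω] at this
        linarith
    nlinarith
  refine ⟨m, fun z => ?_, fun z w hzw => ?_⟩
  · by_cases hzω : z = ω
    · rw [hzω]; exact hω.ne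
    · exact right_ne_zero_of_mul (hz z hzω).ne
  · rw [form_graphVector, ← hD]
    by_cases hzω : z = ω
    · subst hzω
      have h1 := hz w hzw.symm
      have := mul_pos_of_neg_of_neg h1 hω
      linarith
    · by_cases hwω : w = ω
      · rw [hwω]
        have h1 := hz z hzω
        rw [hDs] at h1
        have := mul_pos_of_neg_of_neg h1 hω
        linarith
      · have h1 := mul_pos_of_neg_of_neg (hz z hzω) (hz w hwω)
        have h2 := htri (a := ω) (b := z) (c := w) (Ne.symm hzω) hzw hwω
        rw [hDs w ω] at h2
        have h3 : 0 < (D ω z * D ω w) ^ 2 *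
            (D z w * (form m (graphVector φ z) * form m (graphVector φ w))) := by
          have := _root_.mul_pos h1 h2
          linarith
        have := pos_of_mul_pos_right h3 (sq_nonneg _)
        linarith

/-- `homCoord` jumps at infinity, but the normalized vector ignores rescaling, so continuous local
representatives suffice. -/
theorem isCompact_range_normalized {m : R22} (hm : ∀ z, form m (graphVector φ z) ≠ 0) :
    IsCompact (range fun z => (form m (graphVector φ z))⁻¹ • graphVector φ z) := by
  refine isCompact_range (continuous_iff_continuousAt.2 fun z₀ => ?_)
  obtain ⟨r, hr, hrc⟩ := exists_continuousAt_smul_homCoord z₀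
  obtain ⟨s, hs, hsc⟩ := exists_continuousAt_smul_homCoord (φ z₀)
  have hsc' : ContinuousAt (fun z => s (φ z) • homCoord (φ z)) z₀ :=
    ContinuousAt.comp (f := φ) hsc φ.continuous.continuousAt
  have hG : ContinuousAt (fun z => (r z * s (φ z)) • graphVector φ z) z₀ := by
    have := (continuous_segre.continuousAt (x := (r z₀ • homCoord z₀,
      s (φ z₀) • homCoord (φ z₀)))).comp_of_eq (hrc.prodMk hsc') rfl
    refine this.congr (Filter.Eventually.of_forall fun z => ?_)
    simp only [Function.comp, segre_smul_left, segre_smul_right, smul_smul, graphVector,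
      mul_comm (s (φ z))]
  have hF : ContinuousAt (fun z => form m ((r z * s (φ z)) • graphVector φ z)) z₀ :=
    (continuous_form.continuousAt).comp_of_eq (continuousAt_const.prodMk hG) rfl
  have hne : ∀ z, r z * s (φ z) ≠ 0 := fun z => mul_ne_zero (hr z) (hs _)
  refine ((hF.inv₀ ?_).smul hG).congr (Filter.Eventually.of_forall fun z => ?_)
  · rw [form_smul_right]; exact mul_ne_zero (hne z₀) (hm z₀)
  · have := hm z
    have := hr z
    have := hs (φ z)
    simp only [Pi.inv_apply, Pi.smul_apply', form_smul_right, smul_smul]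
    congr 1
    field_simp

/-! ### From the projective hull to a convex hull in a chart -/

theorem form_rep_mk {v : R22} (hv : v ≠ 0) :
    ∃ c : ℝ, c ≠ 0 ∧ ∀ n, form n (Projectivization.mk ℝ v hv).rep = c * form n v := by
  obtain ⟨c, hc⟩ := Projectivization.exists_smul_eq_mk_rep ℝ v hv
  exact ⟨c, c.ne_zero, fun n => by rw [← hc, ← form_smul_right]; rfl⟩

theorem form_div_form_of_mem_hull {m n v : R22} (hm : ∀ z, form m (graphVector φ z) ≠ 0)
    (hn : ∀ z, 0 < form n ((form m (graphVector φ z))⁻¹ • graphVector φ z)) (hv : v ≠ 0)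
    (hx : Projectivization.mk ℝ v hv ∈ hull (graphCurve φ)) :
    form m v ≠ 0 ∧ 0 ≤ form n ((form m v)⁻¹ • v) := by
  have hn' : ∀ z, form n (graphVector φ z) ≠ 0 := fun z h0 => by
    have := hn z
    rw [form_smul_right, h0] at this
    simp at this
  have hdisj : ∀ l, (∀ z, form l (graphVector φ z) ≠ 0) → Disjoint (plane l) (graphCurve φ) := by
    intro l hl
    rw [Set.disjoint_right]
    rintro _ ⟨z, rfl⟩ hz
    obtain ⟨c, hc, hcf⟩ := form_rep_mk (segre_homCoord_ne_zero z (φ z))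
    change form l (bdryPoint z (φ z)).rep = 0 at hz
    rw [bdryPoint, hcf] at hz
    exact (mul_ne_zero hc (hl z)) hz
  have key := hx n m (hdisj n hn') (hdisj m hm) (by
    rintro _ ⟨z, rfl⟩
    obtain ⟨c, hc, hcf⟩ := form_rep_mk (segre_homCoord_ne_zero z (φ z))
    have h1 := hn z
    rw [form_smul_right] at h1
    change form m (bdryPoint z (φ z)).rep ≠ 0 ∧
      0 ≤ form n (bdryPoint z (φ z)).rep / form m (bdryPoint z (φ z)).rep
    rw [bdryPoint, hcf, hcf, mul_div_mul_left _ _ hc, div_eq_inv_mul]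
    exact ⟨mul_ne_zero hc (hm z), h1.le⟩)
  obtain ⟨c, hc, hcf⟩ := form_rep_mk hv
  change form m _ ≠ 0 ∧ 0 ≤ form n _ / form m _ at key
  rw [hcf, hcf, mul_div_mul_left _ _ hc, div_eq_inv_mul] at key
  exact ⟨right_ne_zero_of_mul key.1, by rw [form_smul_right]; exact key.2⟩

/-- A point outside the convex hull is cut off by a functional positive on the compact curve. Its
plane misses the curve, so its half-space is among those defining `hull`. -/
theorem mem_convexHull_of_mem_hull {m v : R22} (hm : ∀ z, form m (graphVector φ z) ≠ 0)
    (hv : v ≠ 0) (hx : Projectivization.mk ℝ v hv ∈ hull (graphCurve φ)) :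
    form m v ≠ 0 ∧ (form m v)⁻¹ • v ∈
      convexHull ℝ (range fun z => (form m (graphVector φ z))⁻¹ • graphVector φ z) := by
  have hm1 : ∀ z, form m ((form m (graphVector φ z))⁻¹ • graphVector φ z) = 1 := fun z => by
    rw [form_smul_right, inv_mul_cancel₀ (hm z)]
  have hmv := (form_div_form_of_mem_hull hm (n := m)
    (fun z => by rw [hm1]; exact one_pos) hv hx).1
  refine ⟨hmv, ?_⟩
  by_contra hnot
  obtain ⟨n, hn, hnx⟩ := exists_form_neg_of_notMem (isCompact_range_normalized hm)
    (by rintro _ ⟨z, rfl⟩; exact hm1 z) (by rw [form_smul_right, inv_mul_cancel₀ hmv]) hnot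
  exact absurd (form_div_form_of_mem_hull hm (fun z => hn _ ⟨z, rfl⟩) hv hx).2 (not_le.2 hnx)

/-- The whole normalization goes into the second factor; its sign is the one that makes the mutual
products negative, and cross-ratios do not see it. -/
theorem isPositiveLift_homCoord {m : R22}
    (hm : ∀ z, form m (graphVector φ z) ≠ 0)
    (hpos : ∀ z w, z ≠ w → form (graphVector φ z) (graphVector φ w) *
        (form m (graphVector φ z) * form m (graphVector φ w)) < 0) :
    IsPositiveLift homCoord
      (fun z => (form m (graphVector φ z))⁻¹ • homCoord (φ z)) where
  pos z w hzw := by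
    have h1 := hpos z w hzw
    rw [form_graphVector] at h1
    rw [det2_smul_left, det2_smul_right]
    have hz := hm z
    have hw := hm w
    have h2 : 0 < ((form m (graphVector φ z))⁻¹ * (form m (graphVector φ w))⁻¹) ^ 2 := by
      positivity
    have h3 : det2 (homCoord z) (homCoord w) * ((form m (graphVector φ z))⁻¹ *
        ((form m (graphVector φ w))⁻¹ * det2 (homCoord (φ z)) (homCoord (φ w)))) =
        ((form m (graphVector φ z))⁻¹ * (form m (graphVector φ w))⁻¹) ^ 2 *
        (diff z w * diff (φ z) (φ w) *
          (form m (graphVector φ z) * form m (graphVector φ w))) := by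
      simp only [diff]
      field_simp
    rw [h3]
    exact _root_.mul_pos h2 (by linarith)
  ne_zero := homCoord_ne_zero
  surj := exists_homCoord_eq_smul

theorem abs_log_le_crossRatioNorm (hφ : crossRatioNorm φ < ⊤) {z₁ z₂ z₃ z₄ : OnePoint ℝ}
    (h : crossRatio z₁ z₂ z₃ z₄ = -1) :
    abs (Real.log (abs (crossRatio (φ z₁) (φ z₂) (φ z₃) (φ z₄)))) ≤ (crossRatioNorm φ).toReal := by
  rw [← ENNReal.ofReal_le_iff_le_toReal hφ.ne]
  exact le_iSup_of_le z₁ <| le_iSup_of_le z₂ <| le_iSup_of_le z₃ <| le_iSup_of_le z₄ <|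
    le_iSup_of_le h le_rfl

/-- The estimate for a geodesic segment of length less than `π/2`. -/
theorem Quasisymmetric.tan_le_sinh (hφ : Quasisymmetric φ) {u : UnitTimelike} {ℓ : ℝ} (hℓ : 0 < ℓ)
    (hℓ' : ℓ < Real.pi / 2) (h0 : timelikeGeodesic u 0 ∈ hull (graphCurve φ))
    (h1 : timelikeGeodesic u ℓ ∈ hull (graphCurve φ)) :
    Real.tan ℓ ≤ Real.sinh ((crossRatioNorm φ).toReal / 2) := by
  obtain ⟨m, hm, hpos⟩ := hφ.1.exists_form_ne_zero
  have hlift := isPositiveLift_homCoord hm hpos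
  have hseg : ∀ z, segre (homCoord z) ((form m (graphVector φ z))⁻¹ • homCoord (φ z)) =
      (form m (graphVector φ z))⁻¹ • graphVector φ z := fun z => segre_smul_right _ _ _
  have hp := mem_convexHull_of_mem_hull hm _ h0
  have hq := mem_convexHull_of_mem_hull hm _ h1
  refine hlift.tan_le_sinh (fun z₁ z₂ z₃ z₄ hz => ?_) (m := m) (fun z => ?_) ?_
    (form_cos_sin u 0) (form_cos_sin u ℓ) ?_ hℓ hℓ' rfl rfl hp.1 hq.1 ?_ ?_
  · rw [vectorCrossRatio_smul (inv_ne_zero (hm _)) (inv_ne_zero (hm _)) (inv_ne_zero (hm _))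
      (inv_ne_zero (hm _))]
    exact abs_log_le_crossRatioNorm hφ.2 hz
  · rw [hseg, form_smul_right, inv_mul_cancel₀ (hm z)]
  · simp only [hseg]; exact isCompact_range_normalized hm
  · rw [Real.cos_zero, Real.sin_zero, one_smul, zero_smul, add_zero, form_add_right,
      form_smul_right, form_smul_right, u.form_pp, u.form_pv]
    ring
  · simp only [hseg]; exact hp.2
  · simp only [hseg]; exact hq.2

theorem Quasisymmetric.width_le (hφ : Quasisymmetric φ) : width (hull (graphCurve φ)) ≤
    ENNReal.ofReal (Real.arctan (Real.sinh ((crossRatioNorm φ).toReal / 2))) := by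
  refine iSup_le fun u => iSup_le fun ℓ => iSup_le fun hseg => ?_
  rw [← ENNReal.ofReal_coe_nnreal]
  refine ENNReal.ofReal_le_ofReal ?_
  by_contra hcon
  push Not at hcon
  set S := Real.sinh ((crossRatioNorm φ).toReal / 2)
  have hS : 0 ≤ S := Real.sinh_nonneg_iff.2 (by positivity)
  have hA : 0 ≤ Real.arctan S := Real.arctan_nonneg.2 hS
  -- A segment that is too long, possibly beyond π/2, has an initial piece of length t < π/2 that is
  -- still too long.
  obtain ⟨t, ht, ht'⟩ := exists_between (lt_min hcon (Real.arctan_lt_pi_div_two S))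
  have ht0 : 0 < t := hA.trans_lt ht
  have htℓ : t < ℓ := ht'.trans_le (min_le_left _ _)
  have htπ : t < Real.pi / 2 := ht'.trans_le (min_le_right _ _)
  have h := hφ.tan_le_sinh ht0 htπ (hseg 0 ⟨le_rfl, ht0.le.trans htℓ.le⟩)
    (hseg t ⟨ht0.le, htℓ.le⟩)
  have := Real.arctan_strictMono.monotone h
  rw [Real.arctan_tan (by linarith [Real.pi_pos]) htπ] at this
  linarith

end AdSWidth

theorem propositionH (φ : OnePoint ℝ ≃ₜ OnePoint ℝ) (hφ : AdSWidth.Quasisymmetric φ) :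
    AdSWidth.width (AdSWidth.hull (AdSWidth.graphCurve φ)) < ENNReal.ofReal (Real.pi / 2) ∧
    Real.tan (AdSWidth.width (AdSWidth.hull (AdSWidth.graphCurve φ))).toReal ≤
      Real.sinh ((AdSWidth.crossRatioNorm φ).toReal / 2) := by
  have h := hφ.width_le
  set S := Real.sinh ((AdSWidth.crossRatioNorm φ).toReal / 2)
  have hS : 0 ≤ S := Real.sinh_nonneg_iff.2 (by positivity)
  have hlt := Real.arctan_lt_pi_div_two S
  refine ⟨h.trans_lt ((ENNReal.ofReal_lt_ofReal_iff (by positivity)).2 hlt), ?_⟩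
  have hw := ENNReal.toReal_le_of_le_ofReal (Real.arctan_nonneg.2 hS) h
  have hw0 : 0 ≤ (AdSWidth.width (AdSWidth.hull (AdSWidth.graphCurve φ))).toReal :=
    ENNReal.toReal_nonneg
  rw [← Real.tan_arctan S]
  exact Real.strictMonoOn_tan.monotoneOn ⟨by linarith [Real.pi_pos], by linarith⟩
    ⟨by linarith [Real.arctan_nonneg.2 hS, Real.pi_pos], hlt⟩ hw
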